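/- For a real $r>0$ and a subset $E$ of the Euclidean plane, let $N_r(E)$ be the smallest number of open sets of diameter at most $r$ needed to cover $E$. For a non-empty bounded $F\subset\mathbb{R}^2$ let $$\dim_{\rm A}F=\inf\Big\{\alpha\ge 0:\ \exists\,C,\rho>0\ \forall\,0<r<R\le\rho:\ \sup_{x\in F}N_r\big(B(x,R)\cap F\big)\le C\,(R/r)^{\alpha}\Big\},$$ $$\dim_{\rm L}F=\sup\Big\{\alpha\ge 0:\ \exists\,C,\rho>0\ \forall\,0<r<R\le\rho:\ \inf_{x\in F}N_r\big(B(x,R)\cap F\big)\ge C\,(R/r)^{\alpha}\Big\},$$ where $B(x,R)$ is the closed ball, let $\dim_{\rm H}F$ be the Hausdorff dimension, and let $\dim_{\rm B}F$ be the common value, if they agree, of the lower and upper box dimensions $\liminf_{r\to0}\frac{\log N_r(F)}{-\log r}$ and $\limsup_{r\to0}\frac{\log N_r(F)}{-\log r}$. A *pattern* is a set of at least two of the closed rectangles into which $[0,1]^2$ is divided in one of the following ways. 1. (Extended Lalley–Gatzouras.) Divide $[0,1]^2$ into columns by finitely many, and at least one, vertical lines, then divide each column independently by finitely many horizontal lines;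 every chosen rectangle must have base at least as long as its height. The same construction with the two coordinates exchanged is also allowed. 2. (Barański.) Divide $[0,1]^2$ by finitely many vertical and finitely many horizontal lines, at least one of each. With each chosen rectangle $[a,a+c]\times[b,b+d]$ associate the map $S(x,y)=(cx+a,\,dy+b)$, which maps $[0,1]^2$ onto it. A *self-affine carpet* is the attractor of the iterated function system $\{S_i\}_{i\in\mathcal I}$ of such a pattern in which at least one $S_i$ is not a similarity, that is, the unique non-empty compact set $F\subset\mathbb{R}^2$ with $F=\bigcup_{i\in\mathcal I}S_i(F)$. **Corollary.** Let $F$ be a self-affine carpet. Then the box dimension $\dim_{\rm B}F$ exists, and either $$\dim_{\rm L}F<\dim_{\rm B}F$$ or $$\dim_{\rm L}F=\dim_{\rm H}F=\dim_{\rm B}F=\dim_{\rm A}F.$$ -/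

import Mathlib

open Set Filter Topology
open scoped NNReal ENNReal

noncomputable section

namespace Carpet

/-! ### Covering numbers and dimensions of subsets of a metric space -/

section Dimensions

variable {X : Type*} [MetricSpace X]

/-- `N_r(E)`: the smallest number of open sets of diameter at most `r` needed to cover `E`
(equal to `⊤` if no finite cover exists). -/
def coveringNumber (r : ℝ) (E : Set X) : ℕ∞ :=
  ⨅ (𝒰 : Set (Set X)) (_ : ∀ U ∈ 𝒰, IsOpen U ∧ Metric.ediam U ≤ ENNReal.ofReal r)
    (_ : E ⊆ ⋃₀ 𝒰), 𝒰.encard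

/-- The Assouad dimension of a non-empty set `F`: the infimum of the exponents `α` for which
there are `C, ρ > 0` with `sup_{x ∈ F} N_r(B(x,R) ∩ F) ≤ C (R/r)^α` for all `0 < r < R ≤ ρ`. -/
def assouadDim (F : Set X) : ℝ≥0∞ :=
  ⨅ (α : ℝ≥0) (_ : ∃ C > (0 : ℝ), ∃ ρ > (0 : ℝ), ∀ r R : ℝ, 0 < r → r < R → R ≤ ρ →
    ∀ x ∈ F, (coveringNumber r (Metric.closedBall x R ∩ F) : ℝ≥0∞)
      ≤ ENNReal.ofReal (C * (R / r) ^ (α : ℝ))), (α : ℝ≥0∞)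

/-- The lower dimension of a non-empty set `F`: the supremum of the exponents `α` for which
there are `C, ρ > 0` with `inf_{x ∈ F} N_r(B(x,R) ∩ F) ≥ C (R/r)^α` for all `0 < r < R ≤ ρ`.
(The exponent `α = 0` is always admissible, so only `α ≥ 0` matters.) -/
def lowerDim (F : Set X) : ℝ≥0∞ :=
  ⨆ (α : ℝ≥0) (_ : ∃ C > (0 : ℝ), ∃ ρ > (0 : ℝ), ∀ r R : ℝ, 0 < r → r < R → R ≤ ρ →
    ∀ x ∈ F, ENNReal.ofReal (C * (R / r) ^ (α : ℝ))
      ≤ (coveringNumber r (Metric.closedBall x R ∩ F) : ℝ≥0∞)), (α : ℝ≥0∞)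

/-- The quotient `log N_r(F) / (-log r)`, meaningful for `F` non-empty and `0 < r < 1`. -/
def boxRatio (F : Set X) (r : ℝ) : ℝ≥0∞ :=
  (ENNReal.log (coveringNumber r F : ℝ≥0∞)).toENNReal / ENNReal.ofReal (-Real.log r)

/-- The lower box dimension. -/
def lowerBoxDim (F : Set X) : ℝ≥0∞ := liminf (boxRatio F) (𝓝[>] (0 : ℝ))

/-- The upper box dimension. -/
def upperBoxDim (F : Set X) : ℝ≥0∞ := limsup (boxRatio F) (𝓝[>] (0 : ℝ))

/-- `F` has box dimension `b`: the lower and upper box dimensions agree, with common value `b`. -/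
def HasBoxDim (F : Set X) (b : ℝ≥0∞) : Prop := lowerBoxDim F = b ∧ upperBoxDim F = b

end Dimensions

/-! ### Self-affine carpets -/

/-- The Euclidean plane. -/
abbrev Plane : Type := EuclideanSpace ℝ (Fin 2)

/-- The rectangle `[left, right] × [bottom, top]`, given by its four sides. -/
structure Rect where
  left : ℝ
  right : ℝ
  bottom : ℝ
  top : ℝ

namespace Rect

/-- The length of the base. -/
def width (Q : Rect) : ℝ := Q.right - Q.left

/-- The height. -/
def height (Q : Rect) : ℝ := Q.top - Q.bottom

/-- The reflected rectangle, with the two coordinates exchanged. -/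
def swap (Q : Rect) : Rect := ⟨Q.bottom, Q.top, Q.left, Q.right⟩

/-- The map `(x, y) ↦ (c x + a, d y + b)` with `c` the width, `d` the height and `(a, b)` the
lower left corner of `Q`; it maps the unit square onto `Q`. -/
def map (Q : Rect) (p : Plane) : Plane :=
  !₂[Q.width * p 0 + Q.left, Q.height * p 1 + Q.bottom]

end Rect

/-- A division of `[0,1]` into `k` non-degenerate intervals `[cut i, cut (i+1)]`. -/
structure Subdivision (k : ℕ) where
  cut : Fin (k + 1) → ℝ
  strictMono : StrictMono cut
  cut_zero : cut 0 = 0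
  cut_last : cut (Fin.last k) = 1

/-- The rectangle whose base is the `i`-th interval of `u` and whose vertical side is the
`j`-th interval of `v`. -/
def Subdivision.rect {m n : ℕ} (u : Subdivision m) (v : Subdivision n) (i : Fin m) (j : Fin n) :
    Rect :=
  ⟨u.cut i.castSucc, u.cut i.succ, v.cut j.castSucc, v.cut j.succ⟩

/-- Extended Lalley-Gatzouras patterns: the unit square is cut into columns by at least one
vertical line, each column is cut independently by horizontal lines, and all the chosen
rectangles have base at least as long as their height. -/
def IsExtendedLalleyGatzouras (P : Set Rect) : Prop :=
  ∃ m : ℕ, 2 ≤ m ∧ ∃ (u : Subdivision m) (n : Fin m → ℕ) (v : ∀ i, Subdivision (n i)),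
    ∀ Q ∈ P, (∃ (i : Fin m) (j : Fin (n i)), Q = u.rect (v i) i j) ∧ Q.height ≤ Q.width

/-- Baranski patterns: the unit square is cut by at least one vertical and at least one
horizontal line, and rectangles of the resulting grid are chosen. -/
def IsBaranski (P : Set Rect) : Prop :=
  ∃ m n : ℕ, 2 ≤ m ∧ 2 ≤ n ∧ ∃ (u : Subdivision m) (v : Subdivision n),
    ∀ Q ∈ P, ∃ (i : Fin m) (j : Fin n), Q = u.rect v i j

/-- A similarity: a map that multiplies all distances by one constant. -/
def IsSimilarity (f : Plane → Plane) : Prop :=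
  ∃ k : ℝ, 0 < k ∧ ∀ p q, dist (f p) (f q) = k * dist p q

/-- `F` is the attractor of the IFS consisting of the maps of the rectangles in `P`: the
(unique) non-empty compact set with `F = ⋃ S_Q(F)`. -/
def IsAttractor (P : Set Rect) (F : Set Plane) : Prop :=
  F.Nonempty ∧ IsCompact F ∧ F = ⋃ Q ∈ P, Q.map '' F

/-- A self-affine carpet: the attractor of an IFS with at least two maps, not all of them
similarities, given by an extended Lalley-Gatzouras pattern (possibly with the roles of the two
axes exchanged) or by a Baranski pattern. -/
def IsSelfAffineCarpet (F : Set Plane) : Prop :=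
  ∃ P : Finset Rect, 2 ≤ P.card ∧
    (IsExtendedLalleyGatzouras (P : Set Rect) ∨
      IsExtendedLalleyGatzouras (Rect.swap '' (P : Set Rect)) ∨
      IsBaranski (P : Set Rect)) ∧
    (∃ Q ∈ P, ¬ IsSimilarity Q.map) ∧
    IsAttractor (P : Set Rect) F

end Carpet

end

noncomputable section

namespace Carpet

/-! ### General facts on covering numbers and dimensions -/

section Metric

variable {X : Type*} [MetricSpace X]

/-! The points of the carpet are coded by letter sequences. The approximate square of side r around
a sequence consists of the sequences that agree with it, in each direction, until the cylinder has
length at most r in that direction. These sets partition the symbol space, and a plane set of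
diameter r meets boundedly many of them, so bounds for their masses become bounds for covering
numbers.

Write c and d for the contraction ratios of a map in directions e and f. Let s make the sum of c^s
over the columns equal to 1, and let t make the sum of c^s d^t over the maps equal to 1. Draw
letters with law c^s d^t until the f-length drops to r, and then columns with law c^s (`splice`).
Squares stopped in f no later than in e (the wide ones) receive mass comparable to r^(s+t), and all
others at most r^(s+t) (`regularAt_splice`). If every square is wide, the box dimension is s + t.
For a Barański carpet with both kinds of maps it is the larger of the exponents of the two
orientations, obtained by adding the two measures.

The sums of d^t over single columns have weighted mean 1. If all of them equal 1, the law c^s d^t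
has column marginals c^s, so a single Bernoulli measure serves all scales; when every square is
wide, all dimensions then agree (`dims_eq_of_regular`). Otherwise some column has sum below 1, hence
a smaller exponent τ < t. After a long run of a map with d < c, which exists in a suitable
orientation because some map is not a similarity, followed by repetitions of this column, a small
ball sees only the product of that column with the projection to e. This bounds the lower dimension
by s + τ (`lowerDim_range_le`).

With maps of both kinds the lower dimension is at most either exponent. If it is not below the
larger one, both orientations have uniform columns and equal exponents, and the sum of the two
Bernoulli measures is regular. -/

lemma coveringNumber_le_card {ι : Type*} {r ρ : ℝ} {E : Set X} (T : Finset ι) (c : ι → X)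
    (hE : E ⊆ ⋃ i ∈ T, Metric.ball (c i) ρ) (hρ : 2 * ρ ≤ r) :
    coveringNumber r E ≤ T.card := by
  classical
  have hU : ∀ U ∈ (T.image fun i => Metric.ball (c i) ρ : Finset (Set X)),
      IsOpen U ∧ Metric.ediam U ≤ ENNReal.ofReal r := by
    intro U hU
    obtain ⟨i, -, rfl⟩ := Finset.mem_image.1 hU
    refine ⟨Metric.isOpen_ball, Metric.ediam_le_of_forall_dist_le fun x hx y hy => ?_⟩
    have := dist_triangle_right x y (c i)
    rw [Metric.mem_ball] at hx hy
    linarith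
  have hc : E ⊆ ⋃₀ ((T.image fun i => Metric.ball (c i) ρ : Finset (Set X)) : Set (Set X)) := by
    refine hE.trans ?_
    simp [sUnion_image]
  refine (iInf₂_le_of_le _ hU (iInf_le_of_le hc le_rfl)).trans ?_
  rw [Set.encard_coe_eq_coe_finsetCard]
  exact_mod_cast Finset.card_image_le

lemma exists_finite_cover {r : ℝ} {E : Set X} (h : coveringNumber r E ≠ ⊤) :
    ∃ 𝒰 : Finset (Set X), (∀ U ∈ 𝒰, Metric.ediam U ≤ ENNReal.ofReal r) ∧
      E ⊆ ⋃₀ (𝒰 : Set (Set X)) ∧ (𝒰.card : ℝ≥0∞) ≤ coveringNumber r E := by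
  have hlt : coveringNumber r E < coveringNumber r E + 1 := by
    lift coveringNumber r E to ℕ using h with n
    exact_mod_cast Nat.lt_succ_self n
  nth_rewrite 1 [coveringNumber] at hlt
  simp only [iInf_lt_iff] at hlt
  obtain ⟨𝒰, h1, h2, h3⟩ := hlt
  rw [ENat.lt_add_one_iff h] at h3
  have hfin : 𝒰.Finite := Set.encard_ne_top_iff.1 (ne_top_of_le_ne_top h h3)
  refine ⟨hfin.toFinset, fun U hU => (h1 U (hfin.mem_toFinset.1 hU)).2, by simpa using h2, ?_⟩
  rw [hfin.encard_eq_coe_toFinset_card] at h3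
  exact_mod_cast ENat.toENNReal_mono h3

/-- Mass distribution: every set of an optimal cover carries mass at most M. An infinite covering
number is harmless because M is non-zero. -/
lemma measure_preimage_le_coveringNumber_mul {Ω : Type*} [MeasurableSpace Ω]
    (μ : MeasureTheory.Measure Ω) (g : Ω → X) {r : ℝ} {M : ℝ≥0∞} (hM : M ≠ 0)
    (h : ∀ U : Set X, Metric.ediam U ≤ ENNReal.ofReal r → μ (g ⁻¹' U) ≤ M) (E : Set X) :
    μ (g ⁻¹' E) ≤ (coveringNumber r E : ℝ≥0∞) * M := by
  by_cases htop : coveringNumber r E = ⊤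
  · rw [htop, ENat.toENNReal_top, ENNReal.top_mul hM]; exact le_top
  obtain ⟨𝒰, h1, h2, h3⟩ := exists_finite_cover htop
  calc μ (g ⁻¹' E) ≤ μ (⋃ U ∈ 𝒰, g ⁻¹' U) := by
        refine MeasureTheory.measure_mono fun w hw => ?_
        obtain ⟨U, hU, hwU⟩ := h2 hw
        simp only [mem_iUnion]
        exact ⟨U, hU, hwU⟩
    _ ≤ ∑ U ∈ 𝒰, μ (g ⁻¹' U) := MeasureTheory.measure_biUnion_finset_le _ _
    _ ≤ ∑ U ∈ 𝒰, M := Finset.sum_le_sum fun U hU => h U (h1 U hU)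
    _ = (𝒰.card : ℝ≥0∞) * M := by rw [Finset.sum_const, nsmul_eq_mul]
    _ ≤ (coveringNumber r E : ℝ≥0∞) * M := by gcongr

lemma exponent_le_of_forall_small {a b c C δ₀ : ℝ} (hc : 0 < c) (hδ₀ : 0 < δ₀)
    (h : ∀ δ, 0 < δ → δ < δ₀ → c * (1 / δ) ^ a ≤ C * (1 / δ) ^ b) : a ≤ b := by
  by_contra! hab
  have h1 : Tendsto (fun x : ℝ => x ^ (a - b)) atTop atTop := tendsto_rpow_atTop (by linarith)
  obtain ⟨x, hx1, hx2⟩ := ((h1.eventually_gt_atTop (C / c)).and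
    (eventually_gt_atTop (1 / δ₀))).exists
  have hx0 : 0 < x := (by positivity : 0 < 1 / δ₀).trans hx2
  have := h (1 / x) (by positivity) (by rw [one_div_lt hx0 hδ₀]; exact hx2)
  rw [one_div_one_div] at this
  rw [div_lt_iff₀ hc, Real.rpow_sub hx0, div_mul_eq_mul_div, lt_div_iff₀ (by positivity)] at hx1
  linarith

/-- For each ratio δ one ball at arbitrarily small scale is enough, since only R/r = 1/δ enters the
definition. What matters is that C does not depend on δ. -/
lemma lowerDim_le {F : Set X} {β : ℝ≥0} {C δ₀ : ℝ} (hδ₀ : 0 < δ₀)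
    (h : ∀ δ, 0 < δ → δ < δ₀ → ∀ ρ > 0, ∃ R, 0 < R ∧ R ≤ ρ ∧ ∃ x ∈ F,
      (coveringNumber (δ * R) (Metric.closedBall x R ∩ F) : ℝ≥0∞)
        ≤ ENNReal.ofReal (C * (1 / δ) ^ (β : ℝ))) : lowerDim F ≤ β := by
  refine iSup₂_le ?_
  rintro α ⟨c, hc, ρ, hρ, hα⟩
  have : (α : ℝ) ≤ β := by
    refine exponent_le_of_forall_small (c := c) (C := C) (δ₀ := min δ₀ 1) hc (by positivity) ?_
    intro δ hδ hδ'
    have hδ1 : δ < 1 := hδ'.trans_le (min_le_right _ _)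
    obtain ⟨R, hR, hRρ, x, hx, hle⟩ := h δ hδ (hδ'.trans_le (min_le_left _ _)) ρ hρ
    have h2 := (hα (δ * R) R (by positivity) (by nlinarith) hRρ x hx).trans hle
    have hdiv : R / (δ * R) = 1 / δ := by field_simp
    rw [hdiv] at h2
    rcases le_or_gt 0 (C * (1 / δ) ^ (β : ℝ)) with h0 | h0
    · exact (ENNReal.ofReal_le_ofReal_iff h0).1 h2
    · rw [ENNReal.ofReal_of_nonpos h0.le, nonpos_iff_eq_zero, ENNReal.ofReal_eq_zero] at h2
      have : 0 < c * (1 / δ) ^ (α : ℝ) := by positivity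
      linarith
  exact_mod_cast this

lemma le_assouadDim {F : Set X} {β : ℝ≥0} {c ρ : ℝ} (hF : F.Nonempty) (hc : 0 < c) (hρ : 0 < ρ)
    (h : ∀ r R : ℝ, 0 < r → r < R → R ≤ ρ → ∀ x ∈ F, ENNReal.ofReal (c * (R / r) ^ (β : ℝ))
      ≤ (coveringNumber r (Metric.closedBall x R ∩ F) : ℝ≥0∞)) : (β : ℝ≥0∞) ≤ assouadDim F := by
  refine le_iInf₂ ?_
  rintro α ⟨C, hC, ρ', hρ', hα⟩
  obtain ⟨x, hx⟩ := hF
  have : (β : ℝ) ≤ α := by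
    refine exponent_le_of_forall_small (c := c) (C := C) (δ₀ := 1) hc one_pos ?_
    intro δ hδ hδ1
    have hR : 0 < min ρ ρ' := by positivity
    have h2 := (h (δ * min ρ ρ') _ (by positivity) (by nlinarith) (min_le_left _ _) x hx).trans
      (hα (δ * min ρ ρ') _ (by positivity) (by nlinarith) (min_le_right _ _) x hx)
    have hdiv : min ρ ρ' / (δ * min ρ ρ') = 1 / δ := by field_simp
    rw [hdiv] at h2
    exact (ENNReal.ofReal_le_ofReal_iff (by positivity)).1 h2
  exact_mod_cast this

lemma tendsto_log_mul_rpow_div {c b : ℝ} (hc : 0 < c) :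
    Tendsto (fun r : ℝ => Real.log (c * (1 / r) ^ b) / (-Real.log r)) (𝓝[>] 0) (𝓝 b) := by
  have h1 : Tendsto (fun r : ℝ => -Real.log r) (𝓝[>] 0) atTop :=
    tendsto_neg_atBot_atTop.comp Real.tendsto_log_nhdsGT_zero
  have h2 : Tendsto (fun r : ℝ => Real.log c / (-Real.log r) + b) (𝓝[>] 0) (𝓝 (0 + b)) :=
    (h1.const_div_atTop _).add_const b
  rw [zero_add] at h2
  refine h2.congr' ?_
  filter_upwards [self_mem_nhdsWithin, h1.eventually_gt_atTop 0] with r hr hr'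
  have hr : 0 < r := hr
  rw [Real.log_mul hc.ne' (by positivity), Real.log_rpow (by positivity), one_div, Real.log_inv,
    add_div, mul_div_cancel_right₀ _ hr'.ne']

lemma hasBoxDim_of_bounds {F : Set X} {b : ℝ≥0} {c C r₀ : ℝ} (hc : 0 < c) (hC : 0 < C)
    (hr₀ : 0 < r₀)
    (h1 : ∀ r, 0 < r → r < r₀ →
      ENNReal.ofReal (c * (1 / r) ^ (b : ℝ)) ≤ (coveringNumber r F : ℝ≥0∞))
    (h2 : ∀ r, 0 < r → r < r₀ →
      (coveringNumber r F : ℝ≥0∞) ≤ ENNReal.ofReal (C * (1 / r) ^ (b : ℝ))) :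
    HasBoxDim F b := by
  have hlim : ∀ a : ℝ, 0 < a → Tendsto (fun r : ℝ =>
      (ENNReal.log (ENNReal.ofReal (a * (1 / r) ^ (b : ℝ)))).toENNReal
        / ENNReal.ofReal (-Real.log r)) (𝓝[>] 0) (𝓝 b) := by
    intro a ha
    have h3 := (ENNReal.continuous_ofReal.tendsto (b : ℝ)).comp
      (tendsto_log_mul_rpow_div (b := b) ha)
    rw [ENNReal.ofReal_coe_nnreal] at h3
    refine h3.congr' ?_
    filter_upwards [Ioo_mem_nhdsGT (zero_lt_one (α := ℝ))] with r hr
    have hr0 : 0 < r := hr.1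
    rw [ENNReal.log_ofReal_of_pos (by positivity), EReal.real_coe_toENNReal, Function.comp_apply,
      ENNReal.ofReal_div_of_pos (by linarith [Real.log_neg hr.1 hr.2])]
  have hmono : ∀ {x y : ℝ≥0∞} (r : ℝ), x ≤ y →
      (ENNReal.log x).toENNReal / ENNReal.ofReal (-Real.log r) ≤
        (ENNReal.log y).toENNReal / ENNReal.ofReal (-Real.log r) := fun r hxy =>
    ENNReal.div_le_div_right (EReal.toENNReal_le_toENNReal (ENNReal.log_le_log hxy)) _
  have ht : Tendsto (boxRatio F) (𝓝[>] 0) (𝓝 b) := by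
    refine tendsto_of_tendsto_of_tendsto_of_le_of_le' (hlim c hc) (hlim C hC) ?_ ?_
    · filter_upwards [Ioo_mem_nhdsGT hr₀] with r hr using hmono r (h1 r hr.1 hr.2)
    · filter_upwards [Ioo_mem_nhdsGT hr₀] with r hr using hmono r (h2 r hr.1 hr.2)
  exact ⟨ht.liminf_eq, ht.limsup_eq⟩

open MeasureTheory in
lemma dimH_le_of_coveringNumber_le {F : Set X} {b : ℝ≥0} {C r₀ : ℝ} (hC : 0 < C)
    (hr₀ : 0 < r₀)
    (h2 : ∀ r, 0 < r → r < r₀ →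
      (coveringNumber r F : ℝ≥0∞) ≤ ENNReal.ofReal (C * (1 / r) ^ (b : ℝ))) :
    dimH F ≤ b := by
  borelize X
  have hr : ∀ n : ℕ, 0 < r₀ / (n + 2) ∧ r₀ / (n + 2) < r₀ := fun n =>
    ⟨by positivity, div_lt_self hr₀ (by linarith [(Nat.cast_nonneg n : (0 : ℝ) ≤ n)])⟩
  have hcov : ∀ n : ℕ, ∃ 𝒰 : Finset (Set X),
      (∀ U ∈ 𝒰, Metric.ediam U ≤ ENNReal.ofReal (r₀ / (n + 2))) ∧
      F ⊆ ⋃₀ (𝒰 : Set (Set X)) ∧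
      (𝒰.card : ℝ≥0∞) ≤ ENNReal.ofReal (C * (1 / (r₀ / (n + 2))) ^ (b : ℝ)) := by
    intro n
    have h3 := h2 _ (hr n).1 (hr n).2
    obtain ⟨𝒰, ha, hb, hc⟩ := exists_finite_cover (r := r₀ / (n + 2)) (E := F) (by
      intro htop
      rw [htop] at h3
      simp at h3)
    exact ⟨𝒰, ha, hb, hc.trans h3⟩
  choose 𝒰 ha hb hc using hcov
  refine dimH_le_of_hausdorffMeasure_ne_top (ne_top_of_le_ne_top ENNReal.ofReal_ne_top
    (?_ : _ ≤ ENNReal.ofReal C))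
  have htend : Tendsto (fun n : ℕ => ENNReal.ofReal (r₀ / (n + 2))) atTop (𝓝 0) := by
    rw [← ENNReal.ofReal_zero]
    refine (ENNReal.continuous_ofReal.tendsto 0).comp ?_
    exact (tendsto_natCast_atTop_atTop.atTop_add tendsto_const_nhds).const_div_atTop _
  refine (Measure.hausdorffMeasure_le_liminf_sum (ι := fun n => {U // U ∈ 𝒰 n}) (b : ℝ) F
    (l := atTop) _ htend (fun n U => U.1)
    (Eventually.of_forall fun n U => ha n U.1 U.2) (Eventually.of_forall fun n x hx => ?_)).trans ?_
  · obtain ⟨U, hU, hxU⟩ := hb n hx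
    exact mem_iUnion.2 ⟨⟨U, hU⟩, hxU⟩
  · refine liminf_le_of_le (by isBoundedDefault) fun a hae => ?_
    obtain ⟨n, hn⟩ := hae.exists
    refine hn.trans ?_
    calc ∑ U : {U // U ∈ 𝒰 n}, Metric.ediam U.1 ^ (b : ℝ)
        ≤ ∑ U : {U // U ∈ 𝒰 n}, ENNReal.ofReal (r₀ / (n + 2)) ^ (b : ℝ) :=
          Finset.sum_le_sum fun U _ => ENNReal.rpow_le_rpow (ha n U.1 U.2) b.2
      _ = (𝒰 n).card * ENNReal.ofReal (r₀ / (n + 2)) ^ (b : ℝ) := by simp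
      _ ≤ ENNReal.ofReal (C * (1 / (r₀ / (n + 2))) ^ (b : ℝ)) *
          ENNReal.ofReal (r₀ / (n + 2)) ^ (b : ℝ) := by gcongr; exact hc n
      _ = ENNReal.ofReal C := by
          have h0 := (hr n).1
          rw [ENNReal.ofReal_rpow_of_pos h0, ← ENNReal.ofReal_mul (by positivity),
            one_div, Real.inv_rpow h0.le, mul_assoc, inv_mul_cancel₀ (by positivity), mul_one]

open MeasureTheory in
lemma le_dimH_of_measure_le [MeasurableSpace X] [BorelSpace X] (μ : Measure X) {F : Set X}
    {b : ℝ≥0} {C : ℝ} (hC : 0 < C) (hF : μ F ≠ 0)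
    (h : ∀ r, 0 < r → r ≤ 1 → ∀ U : Set X, IsClosed U → Metric.ediam U ≤ ENNReal.ofReal r →
      μ U ≤ ENNReal.ofReal (C * r ^ (b : ℝ))) : (b : ℝ≥0∞) ≤ dimH F := by
  rcases eq_or_ne b 0 with rfl | hb0
  · simp
  have hb : 0 < b := pos_iff_ne_zero.2 hb0
  refine le_dimH_of_hausdorffMeasure_ne_zero fun h0 => hF ?_
  have hCinv : (ENNReal.ofReal C)⁻¹ ≠ 0 := by simp
  have hle : (ENNReal.ofReal C)⁻¹ • μ ≤ Measure.hausdorffMeasure (b : ℝ) := by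
    refine Measure.le_hausdorffMeasure _ _ 1 one_pos fun s hs => ?_
    have hbig : ∀ r, 0 < r → r ≤ 1 → Metric.ediam s ≤ ENNReal.ofReal r →
        ((ENNReal.ofReal C)⁻¹ • μ) s ≤ ENNReal.ofReal r ^ (b : ℝ) := by
      intro r hr hr1 hsr
      have h2 := (measure_mono subset_closure).trans (h r hr hr1 (closure s) isClosed_closure
        (by rwa [Metric.ediam_closure]))
      rw [Measure.smul_apply, smul_eq_mul, ENNReal.ofReal_rpow_of_pos hr]
      rw [ENNReal.ofReal_mul hC.le] at h2
      calc _ ≤ (ENNReal.ofReal C)⁻¹ * (ENNReal.ofReal C * ENNReal.ofReal (r ^ (b : ℝ))) := by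
            gcongr
        _ = _ := by
            rw [← mul_assoc, ENNReal.inv_mul_cancel (by simpa using hC) ENNReal.ofReal_ne_top,
              one_mul]
    have hne : Metric.ediam s ≠ ⊤ := ne_top_of_le_ne_top ENNReal.one_ne_top hs
    -- Diameter zero is not an admissible radius, so here the estimate is taken in the limit r → 0.
    rcases eq_or_ne (Metric.ediam s) 0 with hz | hz
    · rw [hz, ENNReal.zero_rpow_of_pos (by exact_mod_cast hb)]
      have ht : Tendsto (fun r : ℝ => ENNReal.ofReal r ^ (b : ℝ)) (𝓝[>] 0) (𝓝 0) := by
        have : Continuous fun r : ℝ => ENNReal.ofReal r ^ (b : ℝ) :=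
          ENNReal.continuous_rpow_const.comp ENNReal.continuous_ofReal
        have h3 := (this.tendsto 0).mono_left (nhdsWithin_le_nhds (s := Ioi 0))
        rwa [ENNReal.ofReal_zero, ENNReal.zero_rpow_of_pos (by exact_mod_cast hb)] at h3
      refine ge_of_tendsto ht ?_
      filter_upwards [Ioo_mem_nhdsGT (zero_lt_one (α := ℝ))] with r hr
      exact hbig r hr.1 hr.2.le (by simp [hz])
    · have h4 := hbig (Metric.ediam s).toReal (ENNReal.toReal_pos hz hne)
        (by simpa using ENNReal.toReal_mono ENNReal.one_ne_top hs)
        (by rw [ENNReal.ofReal_toReal hne])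
      rwa [ENNReal.ofReal_toReal hne] at h4
  have h5 := hle F
  rw [h0, nonpos_iff_eq_zero, Measure.smul_apply, smul_eq_mul, mul_eq_zero] at h5
  exact h5.resolve_left hCinv

end Metric

/-! ### Diagonal iterated function systems on the unit square and their coding -/

/-- A family of maps `x ↦ (len 0 i * x 0 + off 0 i, len 1 i * x 1 + off 1 i)` sending the unit
square into itself, with all contraction ratios in `(kap, lam]`. -/
structure DiagonalIFS (I : Type*) where
  len : Fin 2 → I → ℝ
  off : Fin 2 → I → ℝ
  kap : ℝ
  lam : ℝ
  kap_pos : 0 < kap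
  kap_lt_len : ∀ k i, kap < len k i
  len_le_lam : ∀ k i, len k i ≤ lam
  lam_lt_one : lam < 1
  off_nonneg : ∀ k i, 0 ≤ off k i
  off_add_len_le : ∀ k i, off k i + len k i ≤ 1

namespace DiagonalIFS

variable {I : Type*} (D : DiagonalIFS I)

lemma len_pos (k : Fin 2) (i : I) : 0 < D.len k i := D.kap_pos.trans (D.kap_lt_len k i)

lemma len_lt_one (k : Fin 2) (i : I) : D.len k i < 1 := (D.len_le_lam k i).trans_lt D.lam_lt_one

/-- The two maps have the same image in coordinate `k`. -/
def Same (k : Fin 2) (i j : I) : Prop := D.off k i = D.off k j ∧ D.len k i = D.len k j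

/-- The images of the two maps in coordinate `k` do not overlap. -/
def Disj (k : Fin 2) (i j : I) : Prop :=
  D.off k i + D.len k i ≤ D.off k j ∨ D.off k j + D.len k j ≤ D.off k i

/-- The length in direction `k` of the cylinder of the first `n` letters of `w`. -/
def plen (k : Fin 2) (w : ℕ → I) (n : ℕ) : ℝ := ∏ i ∈ Finset.range n, D.len k (w i)

/-- The left end point in direction `k` of the cylinder of the first `n` letters of `w`. -/
def pos (k : Fin 2) (w : ℕ → I) (n : ℕ) : ℝ := ∑ i ∈ Finset.range n, D.plen k w i * D.off k (w i)

/-- The point of the attractor coded by `w`. -/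
def code (w : ℕ → I) : Plane := WithLp.toLp 2 fun k => ⨆ n, D.pos k w n

variable {D}

lemma Same.refl (k : Fin 2) (i : I) : D.Same k i i := ⟨rfl, rfl⟩

lemma Same.symm {k : Fin 2} {i j : I} (h : D.Same k i j) : D.Same k j i := ⟨h.1.symm, h.2.symm⟩

lemma Same.trans {k : Fin 2} {i j l : I} (h : D.Same k i j) (h' : D.Same k j l) : D.Same k i l :=
  ⟨h.1.trans h'.1, h.2.trans h'.2⟩

variable (D)

@[simp] lemma plen_zero (k : Fin 2) (w : ℕ → I) : D.plen k w 0 = 1 := by simp [plen]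

@[simp] lemma pos_zero (k : Fin 2) (w : ℕ → I) : D.pos k w 0 = 0 := by simp [pos]

lemma plen_succ (k : Fin 2) (w : ℕ → I) (n : ℕ) :
    D.plen k w (n + 1) = D.plen k w n * D.len k (w n) := Finset.prod_range_succ _ _

lemma pos_succ (k : Fin 2) (w : ℕ → I) (n : ℕ) :
    D.pos k w (n + 1) = D.pos k w n + D.plen k w n * D.off k (w n) := Finset.sum_range_succ _ _

lemma plen_pos (k : Fin 2) (w : ℕ → I) (n : ℕ) : 0 < D.plen k w n :=
  Finset.prod_pos fun _ _ => D.len_pos k _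

lemma plen_antitone (k : Fin 2) (w : ℕ → I) : Antitone (D.plen k w) :=
  antitone_nat_of_succ_le fun n => by
    rw [plen_succ]
    exact mul_le_of_le_one_right (D.plen_pos k w n).le (D.len_lt_one k _).le

lemma plen_le_pow (k : Fin 2) (w : ℕ → I) (n : ℕ) : D.plen k w n ≤ D.lam ^ n := by
  calc D.plen k w n ≤ ∏ i ∈ Finset.range n, D.lam :=
        Finset.prod_le_prod (fun _ _ => (D.len_pos k _).le) fun _ _ => D.len_le_lam k _
    _ = D.lam ^ n := by simp

lemma pos_monotone (k : Fin 2) (w : ℕ → I) : Monotone (D.pos k w) :=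
  monotone_nat_of_le_succ fun n => by
    rw [pos_succ]
    linarith [mul_nonneg (D.plen_pos k w n).le (D.off_nonneg k (w n))]

lemma pos_add_plen_antitone (k : Fin 2) (w : ℕ → I) :
    Antitone fun n => D.pos k w n + D.plen k w n :=
  antitone_nat_of_succ_le fun n => by
    rw [pos_succ, plen_succ]
    nlinarith [D.off_add_len_le k (w n), D.plen_pos k w n]

lemma pos_le_pos_add_plen (k : Fin 2) (w : ℕ → I) (m n : ℕ) :
    D.pos k w m ≤ D.pos k w n + D.plen k w n :=
  calc D.pos k w m ≤ D.pos k w (max m n) := D.pos_monotone k w (le_max_left _ _)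
    _ ≤ D.pos k w (max m n) + D.plen k w (max m n) := by linarith [D.plen_pos k w (max m n)]
    _ ≤ _ := D.pos_add_plen_antitone k w (le_max_right m n)

lemma pos_le_code (k : Fin 2) (w : ℕ → I) (n : ℕ) : D.pos k w n ≤ D.code w k :=
  le_ciSup (f := D.pos k w) ⟨_, by rintro _ ⟨m, rfl⟩; exact D.pos_le_pos_add_plen k w m 0⟩ n

lemma code_le (k : Fin 2) (w : ℕ → I) (n : ℕ) : D.code w k ≤ D.pos k w n + D.plen k w n :=
  ciSup_le fun m => D.pos_le_pos_add_plen k w m n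

variable {D}

lemma plen_congr {k : Fin 2} {w w' : ℕ → I} {n : ℕ} (h : ∀ i < n, D.Same k (w' i) (w i)) :
    D.plen k w' n = D.plen k w n :=
  Finset.prod_congr rfl fun i hi => (h i (Finset.mem_range.1 hi)).2

lemma pos_congr {k : Fin 2} {w w' : ℕ → I} {n : ℕ} (h : ∀ i < n, D.Same k (w' i) (w i)) :
    D.pos k w' n = D.pos k w n :=
  Finset.sum_congr rfl fun i hi => by
    have hi := Finset.mem_range.1 hi
    rw [plen_congr fun j hj => h j (hj.trans hi), (h i hi).1]

/-! ### Stopping times and approximate squares. -/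

variable (D)

/-- `n` is the first time at which the cylinders of `w` have length at most `r` in direction `k`. -/
def IsStop (k : Fin 2) (r : ℝ) (w : ℕ → I) (n : ℕ) : Prop := ∀ i, r < D.plen k w i ↔ i < n

lemma exists_isStop (k : Fin 2) {r : ℝ} (hr : 0 < r) (w : ℕ → I) : ∃ n, D.IsStop k r w n := by
  classical
  have hex : ∃ n, D.plen k w n ≤ r := by
    rcases lt_or_ge D.lam 0 with h0 | h0
    · exact ⟨1, ((D.plen_le_pow k w 1).trans (by simpa using h0.le)).trans hr.le⟩
    · obtain ⟨n, hn⟩ := exists_pow_lt_of_lt_one hr D.lam_lt_one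
      exact ⟨n, (D.plen_le_pow k w n).trans hn.le⟩
  refine ⟨Nat.find hex, fun i => ?_⟩
  rw [Nat.lt_find_iff]
  exact ⟨fun h m hm => not_le.2 (h.trans_le (D.plen_antitone k w hm)), fun h => not_le.1 (h i le_rfl)⟩

variable {D}

lemma IsStop.plen_le {k : Fin 2} {r : ℝ} {w : ℕ → I} {n : ℕ} (h : D.IsStop k r w n) :
    D.plen k w n ≤ r := not_lt.1 fun h' => lt_irrefl _ ((h n).1 h')

/-- One letter earlier the length still exceeded r, and a letter shrinks it by a factor above `kap`;
if no letter is read, r ≤ 1 takes over. Strictness lets a grid of mesh `kap * r` hit the interior of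
every stopped interval. -/
lemma IsStop.lt_plen {k : Fin 2} {r : ℝ} {w : ℕ → I} {n : ℕ} (h : D.IsStop k r w n)
    (hr1 : r ≤ 1) : D.kap * r < D.plen k w n := by
  have hk := D.kap_pos
  cases n with
  | zero =>
    rw [plen_zero]
    nlinarith [D.kap_lt_len k (w 0), D.len_lt_one k (w 0)]
  | succ n =>
    have h1 := (h n).2 n.lt_succ_self
    rw [plen_succ]
    nlinarith [D.kap_lt_len k (w n), D.len_pos k (w n), D.plen_pos k w n]

lemma IsStop.congr {k : Fin 2} {r : ℝ} {w w' : ℕ → I} {n : ℕ} (h : D.IsStop k r w n)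
    (hs : ∀ i < n, D.Same k (w' i) (w i)) : D.IsStop k r w' n := by
  intro i
  rcases le_or_gt i n with hi | hi
  · rw [plen_congr fun j hj => hs j (hj.trans_le hi)]
    exact h i
  · refine iff_of_false (not_lt.2 ?_) hi.not_gt
    exact (D.plen_antitone k w' hi.le).trans ((plen_congr hs).trans_le h.plen_le)

variable (D)

/-- The symbolic approximate square of side `r` around `w`. -/
def approx (r : ℝ) (w : ℕ → I) : Set (ℕ → I) :=
  {w' | ∀ k i, r < D.plen k w i → D.Same k (w' i) (w i)}

lemma self_mem_approx (r : ℝ) (w : ℕ → I) : w ∈ D.approx r w := fun _ _ _ => Same.refl _ _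

variable {D}

/-- Stopping times depend only on the letters up to `Same`, so squares of one side length form a
partition. -/
lemma approx_eq_of_mem {r : ℝ} (hr : 0 < r) {w w' : ℕ → I} (h : w' ∈ D.approx r w) :
    D.approx r w' = D.approx r w := by
  have key : ∀ k i, r < D.plen k w' i ↔ r < D.plen k w i := by
    intro k i
    obtain ⟨n, hn⟩ := D.exists_isStop k hr w
    rw [hn i, hn.congr (fun j hj => h k j ((hn j).2 hj)) i]
  ext v
  refine forall₂_congr fun k i => ?_
  rw [key]
  refine imp_congr_right fun hi => ?_
  exact ⟨fun hv => hv.trans (h k i hi), fun hv => hv.trans (h k i hi).symm⟩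

lemma abs_code_sub_le_of_mem_approx {r : ℝ} (hr : 0 < r) {w w' : ℕ → I} (h : w' ∈ D.approx r w)
    (k : Fin 2) : |D.code w' k - D.code w k| ≤ r := by
  obtain ⟨n, hn⟩ := D.exists_isStop k hr w
  have hs : ∀ i < n, D.Same k (w' i) (w i) := fun i hi => h k i ((hn i).2 hi)
  have h1 := D.pos_le_code k w' n
  have h2 := D.code_le k w' n
  rw [pos_congr hs] at h1 h2
  rw [plen_congr hs] at h2
  have := D.pos_le_code k w n
  have := D.code_le k w n
  have := hn.plen_le
  rw [abs_le]
  constructor <;> linarith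

lemma _root_.Carpet.plane_dist_lt {x y : Plane} {r : ℝ} (hr : 0 < r)
    (h : ∀ k, |x k - y k| ≤ r) : dist x y < 2 * r := by
  rw [EuclideanSpace.dist_eq, Fin.sum_univ_two, Real.sqrt_lt' (by positivity), Real.dist_eq,
    Real.dist_eq]
  nlinarith [sq_le_sq' (neg_le_of_abs_le (h 0)) (le_of_abs_le (h 0)), h 0, h 1,
    abs_nonneg (x 0 - y 0), abs_nonneg (x 1 - y 1)]

lemma _root_.Carpet.abs_sub_le_plane_dist (x y : Plane) (k : Fin 2) :
    |x k - y k| ≤ dist x y := by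
  rw [← Real.dist_eq]
  exact PiLp.dist_apply_le x y k

lemma code_mem_ball_of_mem_approx {r : ℝ} (hr : 0 < r) {w w' : ℕ → I} (h : w' ∈ D.approx r w) :
    D.code w' ∈ Metric.ball (D.code w) (2 * r) :=
  plane_dist_lt hr (abs_code_sub_le_of_mem_approx hr h)

/-! ### Separation -/

/-- As long as the earlier letters agree, both intervals of level i + 1 are images under one affine
map of the intervals of the i-th letters. A common interior point rules out that those are disjoint.
-/
lemma not_disj_of_mem_Ioo {k : Fin 2} {w w' : ℕ → I} {m n i : ℕ} {x : ℝ}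
    (hx : x ∈ Ioo (D.pos k w m) (D.pos k w m + D.plen k w m))
    (hx' : x ∈ Ioo (D.pos k w' n) (D.pos k w' n + D.plen k w' n)) (hm : i < m) (hn : i < n)
    (hs : ∀ j < i, D.Same k (w' j) (w j)) : ¬ D.Disj k (w' i) (w i) := by
  have h1 := D.pos_monotone k w (Nat.succ_le_of_lt hm)
  have h2 := D.pos_monotone k w' (Nat.succ_le_of_lt hn)
  have h3 := D.pos_add_plen_antitone k w (Nat.succ_le_of_lt hm)
  have h4 := D.pos_add_plen_antitone k w' (Nat.succ_le_of_lt hn)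
  simp only [Nat.succ_eq_add_one, pos_succ, plen_succ, pos_congr hs, plen_congr hs] at h1 h2 h3 h4
  have hp := D.plen_pos k w i
  obtain ⟨ha, hb⟩ := hx
  obtain ⟨hc, hd⟩ := hx'
  rintro (h | h) <;> nlinarith

variable (D)

/-- The separation properties of a carpet whose columns (in direction `e`) are well defined:
either it is also divided into rows, or the approximate squares are never longer in direction `f`
than in direction `e`. -/
structure Separated (e f : Fin 2) : Prop where
  ne : e ≠ f
  fst : ∀ i j, D.Same e i j ∨ D.Disj e i j
  snd : (∀ i j, D.Same f i j ∨ D.Disj f i j) ∨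
    ((∀ i j, D.Same e i j → D.Same f i j ∨ D.Disj f i j) ∧ ∀ i, D.len f i ≤ D.len e i)
  inj : ∀ i j, D.Same e i j → D.Same f i j → i = j

variable {D}

lemma _root_.Carpet.fin_two_forall {e f : Fin 2} (h : e ≠ f) {p : Fin 2 → Prop} (he : p e)
    (hf : p f) (k : Fin 2) : p k := by
  have : k = e ∨ k = f := by omega
  rcases this with rfl | rfl <;> assumption

lemma same_of_forall_not_disj {k : Fin 2} {w w' : ℕ → I} {n : ℕ}
    (h : ∀ i < n, (∀ j < i, D.Same k (w' j) (w j)) → D.Same k (w' i) (w i)) :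
    ∀ i < n, D.Same k (w' i) (w i) := by
  intro i
  induction i using Nat.strong_induction_on with
  | _ i ih => exact fun hi => h i hi fun j hj => ih j hj (hj.trans hi)

lemma IsStop.le_of_forall_same {k : Fin 2} {r : ℝ} {w w' : ℕ → I} {m n : ℕ}
    (hm : D.IsStop k r w m) (hn : D.IsStop k r w' n)
    (h : ∀ i < min m n, D.Same k (w' i) (w i)) : m ≤ n := by
  by_contra! hlt
  rw [min_eq_right hlt.le] at h
  have h1 := (hm n).2 hlt
  rw [← plen_congr h] at h1
  exact h1.not_ge hn.plen_le

lemma plen_le_plen {e f : Fin 2} (h : ∀ i, D.len f i ≤ D.len e i) (w : ℕ → I) (n : ℕ) :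
    D.plen f w n ≤ D.plen e w n :=
  Finset.prod_le_prod (fun _ _ => (D.len_pos f _).le) fun _ _ => h _

/-- If the approximate squares of `w` and `w'` overlap, they agree. -/
lemma mem_approx_of_overlap {e f : Fin 2} (hD : D.Separated e f) {r : ℝ} {w w' : ℕ → I}
    {m n : Fin 2 → ℕ} (hm : ∀ k, D.IsStop k r w (m k)) (hn : ∀ k, D.IsStop k r w' (n k))
    (h : ∀ k, ∃ x, x ∈ Ioo (D.pos k w (m k)) (D.pos k w (m k) + D.plen k w (m k)) ∧
      x ∈ Ioo (D.pos k w' (n k)) (D.pos k w' (n k) + D.plen k w' (n k))) :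
    w' ∈ D.approx r w := by
  have hle : ∀ k, (∀ i < min (m k) (n k), D.Same k (w' i) (w i)) →
      ∀ i, r < D.plen k w i → D.Same k (w' i) (w i) := by
    intro k hk i hi
    have h1 := (hm k).le_of_forall_same (hn k) hk
    rw [min_eq_left h1] at hk
    exact hk i ((hm k i).1 hi)
  have he : ∀ i, r < D.plen e w i → D.Same e (w' i) (w i) := by
    refine hle e (same_of_forall_not_disj fun i hi hs => ?_)
    obtain ⟨x, hx, hx'⟩ := h e
    rw [lt_min_iff] at hi
    exact (hD.fst _ _).resolve_right (not_disj_of_mem_Ioo hx hx' hi.1 hi.2 hs)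
  refine fin_two_forall hD.ne he (hle f (same_of_forall_not_disj fun i hi hs => ?_))
  obtain ⟨x, hx, hx'⟩ := h f
  rw [lt_min_iff] at hi
  have hnd := not_disj_of_mem_Ioo hx hx' hi.1 hi.2 hs
  rcases hD.snd with h2 | ⟨h2, h3⟩
  · exact (h2 _ _).resolve_right hnd
  -- Cells are separated only within a column here. Since f-lengths never exceed e-lengths, a letter
  -- not yet stopped in f is not stopped in e either, so its column is already known.
  · exact (h2 _ _ (he i (((hm f i).2 hi.1).trans_le (plen_le_plen h3 w i)))).resolve_right hnd

variable (D) in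
/-- A bound for the number of approximate squares of side `r` meeting a set of diameter `r`. -/
def multiplicity : ℕ := (2 * ⌈3 / D.kap + 1⌉₊ + 1) ^ 2

lemma _root_.Carpet.exists_int_mul_mem_Ioo {a l h : ℝ} (hh : 0 < h) (hl : h < l) :
    h * (⌊a / h⌋ + 1) ∈ Ioo a (a + l) := by
  have h1 := Int.lt_floor_add_one (a / h)
  have h2 := Int.floor_le (a / h)
  rw [div_lt_iff₀ hh] at h1
  rw [le_div_iff₀ hh] at h2
  constructor <;> linarith

/-- Label a square by the grid cell, of mesh `kap * r`, of its lower left corner. The next grid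
point lies inside the square in each direction, so squares with equal labels overlap and hence
coincide; few labels are possible within diameter r. -/
lemma exists_cover_approx {e f : Fin 2} (hD : D.Separated e f) {r : ℝ} (hr : 0 < r) (hr1 : r ≤ 1)
    {S : Set (ℕ → I)} (hS : ∀ w ∈ S, ∀ w' ∈ S, ∀ k, |D.code w k - D.code w' k| ≤ r) :
    ∃ T : Finset (ℕ → I), T.card ≤ D.multiplicity ∧ S ⊆ ⋃ w ∈ T, D.approx r w := by
  classical
  rcases S.eq_empty_or_nonempty with rfl | ⟨w₀, hw₀⟩
  · exact ⟨∅, by simp, by simp⟩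
  have hex : ∀ w : ℕ → I, ∃ n : Fin 2 → ℕ, ∀ k, D.IsStop k r w (n k) := fun w => by
    choose n hn using fun k => D.exists_isStop k hr w
    exact ⟨n, hn⟩
  choose n hn using hex
  set h : ℝ := D.kap * r with hh
  have hk := D.kap_pos
  have hh0 : 0 < h := by positivity
  let g : (ℕ → I) → Fin 2 → ℤ := fun w k => ⌊D.pos k w (n w k) / h⌋
  -- The corners differ by less than 3r, which is 3 / `kap` meshes; rounding down costs one more.
  set z : ℕ := ⌈3 / D.kap + 1⌉₊ with hz
  have hg : ∀ w ∈ S, g w ∈ Fintype.piFinset fun k => Finset.Icc (g w₀ k - z) (g w₀ k + z) := by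
    intro w hw
    rw [Fintype.mem_piFinset]
    intro k
    have h1 := hS w hw w₀ hw₀ k
    rw [abs_le] at h1
    have := D.pos_le_code k w (n w k)
    have := D.code_le k w (n w k)
    have := D.pos_le_code k w₀ (n w₀ k)
    have := D.code_le k w₀ (n w₀ k)
    have := (hn w k).plen_le
    have := (hn w₀ k).plen_le
    have hzr : 3 / D.kap + 1 ≤ z := Nat.le_ceil _
    have e1 : (3 * r) / h = 3 / D.kap := by rw [hh]; field_simp
    have d1 : D.pos k w (n w k) / h - D.pos k w₀ (n w₀ k) / h ≤ 3 / D.kap := by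
      rw [← e1, ← sub_div]; gcongr; linarith
    have d2 : D.pos k w₀ (n w₀ k) / h - D.pos k w (n w k) / h ≤ 3 / D.kap := by
      rw [← e1, ← sub_div]; gcongr; linarith
    have f1 := Int.floor_le (D.pos k w (n w k) / h)
    have f2 := Int.lt_floor_add_one (D.pos k w (n w k) / h)
    have f3 := Int.floor_le (D.pos k w₀ (n w₀ k) / h)
    have f4 := Int.lt_floor_add_one (D.pos k w₀ (n w₀ k) / h)
    rw [Finset.mem_Icc]
    constructor
    · have : ((g w₀ k - z : ℤ) : ℝ) ≤ (g w k : ℤ) := by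
        push_cast
        simp only [g]
        linarith
      exact_mod_cast this
    · have : ((g w k : ℤ) : ℝ) ≤ (g w₀ k + z : ℤ) := by
        push_cast
        simp only [g]
        linarith
      exact_mod_cast this
  have hgeq : ∀ w w', g w = g w' → w' ∈ D.approx r w := by
    intro w w' hww
    refine mem_approx_of_overlap hD (hn w) (hn w') fun k => ⟨h * (g w k + 1), ?_, ?_⟩
    · exact exists_int_mul_mem_Ioo hh0 ((hn w k).lt_plen hr1)
    · rw [hww]
      exact exists_int_mul_mem_Ioo hh0 ((hn w' k).lt_plen hr1)
  set G := Fintype.piFinset fun k => Finset.Icc (g w₀ k - z) (g w₀ k + (z : ℤ)) with hG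
  let c : (Fin 2 → ℤ) → (ℕ → I) := fun v => if hv : ∃ w, g w = v then hv.choose else w₀
  have hc : ∀ w, g (c (g w)) = g w := fun w => by
    have hv : ∃ w', g w' = g w := ⟨w, rfl⟩
    simp only [c, dif_pos hv]
    exact hv.choose_spec
  refine ⟨G.image c, Finset.card_image_le.trans ?_, fun w hw => ?_⟩
  · rw [hG, Fintype.card_piFinset, Fin.prod_univ_two, Int.card_Icc, Int.card_Icc, multiplicity,
      ← hz, sq]
    apply le_of_eq
    congr 1 <;> omega
  · simp only [mem_iUnion]
    exact ⟨c (g w), Finset.mem_image_of_mem _ (hg w hw), hgeq _ _ (hc w)⟩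

end DiagonalIFS

open MeasureTheory

/-! ### Measures on the symbol space -/

lemma infinitePi_real_pi {J : ℕ → Type*} [∀ i, MeasurableSpace (J i)] (μ : ∀ i, Measure (J i))
    [∀ i, IsProbabilityMeasure (μ i)] (s : Finset ℕ) {t : ∀ i, Set (J i)}
    (ht : ∀ i ∈ s, MeasurableSet (t i)) :
    (Measure.infinitePi μ).real (Set.pi s t) = ∏ i ∈ s, (μ i).real (t i) := by
  simp [measureReal_def, Measure.infinitePi_pi μ ht, ENNReal.toReal_prod]

open Classical in
lemma exists_weight_measure {I : Type*} [Fintype I] [MeasurableSpace I] [DiscreteMeasurableSpace I]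
    (p : I → ℝ) (hp : ∀ i, 0 ≤ p i) (hsum : ∑ i, p i = 1) :
    ∃ μ : Measure I, IsProbabilityMeasure μ ∧ ∀ E : Set I, μ.real E = ∑ i with i ∈ E, p i := by
  let P : PMF I := PMF.ofFintype (fun i => ENNReal.ofReal (p i)) (by
    rw [← ENNReal.ofReal_sum_of_nonneg fun i _ => hp i, hsum, ENNReal.ofReal_one])
  refine ⟨P.toMeasure, inferInstance, fun E => ?_⟩
  rw [measureReal_def, PMF.toMeasure_apply_fintype, ENNReal.toReal_sum, Finset.sum_filter]
  · refine Finset.sum_congr rfl fun i _ => ?_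
    by_cases h : i ∈ E <;> simp [h, P, hp i]
  · intro i _
    by_cases h : i ∈ E <;> simp [h, P]

namespace DiagonalIFS

variable {I : Type*} {D : DiagonalIFS I}

/-! ### Wide squares and spliced sequences. -/

variable (D) in
/-- In the approximate square of side `r` around `w`, the cylinder is stopped in direction `f`
not later than in direction `e`. -/
def Wide (e f : Fin 2) (r : ℝ) (w : ℕ → I) : Prop := ∀ i, r < D.plen f w i → r < D.plen e w i

lemma wide_or_wide (e f : Fin 2) (r : ℝ) (w : ℕ → I) : D.Wide e f r w ∨ D.Wide f e r w := by
  by_contra! h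
  simp only [Wide, not_forall, not_lt] at h
  obtain ⟨⟨i, hi, hi'⟩, j, hj, hj'⟩ := h
  rcases le_total i j with hij | hij
  · linarith [D.plen_antitone e w hij]
  · linarith [D.plen_antitone f w hij]

lemma wide_of_le {e f : Fin 2} (h : ∀ i, D.len f i ≤ D.len e i) (r : ℝ) (w : ℕ → I) :
    D.Wide e f r w := fun i hi => hi.trans_le (plen_le_plen h w i)

lemma plen_rpow (k : Fin 2) (w : ℕ → I) (n : ℕ) (s : ℝ) :
    D.plen k w n ^ s = ∏ i ∈ Finset.range n, D.len k (w i) ^ s :=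
  (Real.finsetProd_rpow _ _ (fun _ _ => (D.len_pos k _).le) s).symm

lemma wide_iff {e f : Fin 2} {r : ℝ} {w : ℕ → I} {m n : ℕ} (hm : D.IsStop e r w m)
    (hn : D.IsStop f r w n) : D.Wide e f r w ↔ n ≤ m := by
  simp only [Wide, hm _, hn _]
  exact ⟨fun h => by by_contra! h'; exact lt_irrefl _ (h m h'), fun h i hi => hi.trans_le h⟩

section Measurability

variable [MeasurableSpace I] [DiscreteMeasurableSpace I]

lemma measurable_plen (k : Fin 2) (n : ℕ) : Measurable fun w : ℕ → I => D.plen k w n :=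
  Finset.measurable_prod _ fun i _ => (Measurable.of_discrete (f := D.len k)).comp
    (measurable_pi_apply i)

lemma measurable_pos (k : Fin 2) (n : ℕ) : Measurable fun w : ℕ → I => D.pos k w n :=
  Finset.measurable_sum _ fun i _ => (measurable_plen k i).mul
    ((Measurable.of_discrete (f := D.off k)).comp (measurable_pi_apply i))

lemma measurable_code : Measurable D.code :=
  (MeasurableEquiv.toLp 2 (Fin 2 → ℝ)).measurable.comp
    (measurable_pi_iff.2 fun k => Measurable.iSup fun n => measurable_pos k n)

lemma measurableSet_approx (r : ℝ) (w : ℕ → I) : MeasurableSet (D.approx r w) := by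
  have : D.approx r w = ⋂ k, ⋂ i, {w' : ℕ → I | r < D.plen k w i → D.Same k (w' i) (w i)} := by
    ext; simp [approx]
  rw [this]
  refine MeasurableSet.iInter fun k => MeasurableSet.iInter fun i => ?_
  exact (measurable_pi_apply (X := fun _ : ℕ => I) i) (MeasurableSet.of_discrete
    (s := {j : I | r < D.plen k w i → D.Same k j (w i)}))

variable (D) in
/-- Follow the letters `a (ζ i)` until the length in direction `f` drops to `r`, then `b (ζ i)`. -/
def splice {J : Type*} (f : Fin 2) (r : ℝ) (a b : J → I) (ζ : ℕ → J) (i : ℕ) : I :=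
  open Classical in if r < D.plen f (fun j => a (ζ j)) i then a (ζ i) else b (ζ i)

lemma measurable_splice {J : Type*} [MeasurableSpace J] {f : Fin 2} {r : ℝ} {a b : J → I}
    (ha : Measurable a) (hb : Measurable b) : Measurable (D.splice f r a b) := by
  refine measurable_pi_iff.2 fun i => Measurable.ite ?_ (ha.comp (measurable_pi_apply i))
    (hb.comp (measurable_pi_apply i))
  refine measurableSet_lt measurable_const ((measurable_plen f i).comp ?_)
  exact measurable_pi_iff.2 fun j => ha.comp (measurable_pi_apply j)

end Measurability

lemma splice_of_lt {J : Type*} {f : Fin 2} {r : ℝ} {a b : J → I} {ζ : ℕ → J} {w : ℕ → I} {n : ℕ}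
    (hn : D.IsStop f r w n) (h : ∀ i < n, D.Same f (a (ζ i)) (w i)) (i : ℕ) :
    D.splice f r a b ζ i = if i < n then a (ζ i) else b (ζ i) := by
  rw [splice]
  congr 1
  exact propext (hn.congr (w' := fun j => a (ζ j)) h i)

/-- The switching time is read off the sequence itself, so letters are identified one by one:
agreement of the earlier ones in direction f shows that the switch has not yet happened. -/
lemma same_of_splice {J : Type*} {f : Fin 2} {r : ℝ} {a b : J → I} {ζ : ℕ → J} {w : ℕ → I} {n : ℕ}
    (hn : D.IsStop f r w n) (h : ∀ i < n, D.Same f (D.splice f r a b ζ i) (w i)) :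
    ∀ i < n, D.Same f (a (ζ i)) (w i) := by
  refine same_of_forall_not_disj (w' := fun j => a (ζ j)) fun i hi hs => ?_
  have h1 := h i hi
  rw [splice, if_pos] at h1
  · exact h1
  · rw [plen_congr (w' := fun j => a (ζ j)) hs]
    exact (hn i).2 hi

lemma approx_iff {e f : Fin 2} {r : ℝ} {w w' : ℕ → I} {m n : ℕ} (hef : e ≠ f) (hm : D.IsStop e r w m)
    (hn : D.IsStop f r w n) : w' ∈ D.approx r w ↔
      (∀ i < m, D.Same e (w' i) (w i)) ∧ ∀ i < n, D.Same f (w' i) (w i) := by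
  constructor
  · exact fun h => ⟨fun i hi => h e i ((hm i).2 hi), fun i hi => h f i ((hn i).2 hi)⟩
  · rintro ⟨h1, h2⟩
    exact fin_two_forall hef (fun i hi => h1 i ((hm i).1 hi)) fun i hi => h2 i ((hn i).1 hi)

section Splice

variable [MeasurableSpace I] [DiscreteMeasurableSpace I]
  {J : Type*} [MeasurableSpace J] {Q : Measure J} [IsProbabilityMeasure Q]
  {e f : Fin 2} {r s t : ℝ} {a b : J → I}

lemma measurableSet_comp {a : J → I} (ha : Measurable a) (p : I → Prop) :
    MeasurableSet {j | p (a j)} := ha (MeasurableSet.of_discrete (s := {i | p i}))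

/-- For n ≤ m the square is a product event: the first n letters are prescribed in both directions,
hence exactly by injectivity, and the next m - n only up to their column. Independence gives the
exact mass. -/
lemma real_splice_of_wide (ha : Measurable a) (hb : Measurable b) (hef : e ≠ f)
    (hinj : ∀ i j, D.Same e i j → D.Same f i j → i = j)
    (h1 : ∀ i, Q.real {j | a j = i} = D.len e i ^ s * D.len f i ^ t)
    (h2 : ∀ i, Q.real {j | D.Same e (b j) i} = D.len e i ^ s)
    {w : ℕ → I} {m n : ℕ} (hm : D.IsStop e r w m) (hn : D.IsStop f r w n) (hnm : n ≤ m) :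
    (Measure.infinitePi fun _ : ℕ => Q).real (D.splice f r a b ⁻¹' D.approx r w) =
      D.plen e w m ^ s * D.plen f w n ^ t := by
  have hset : D.splice f r a b ⁻¹' D.approx r w = Set.pi (Finset.range m)
      fun i => if i < n then {j | a j = w i} else {j | D.Same e (b j) (w i)} := by
    ext ζ
    rw [mem_preimage, approx_iff hef hm hn]
    simp only [Set.mem_pi, Finset.coe_range, Set.mem_Iio]
    constructor
    · rintro ⟨h3, h4⟩ i hi
      have h5 := splice_of_lt (b := b) hn (same_of_splice hn h4) i
      split_ifs with hin
      · rw [if_pos hin] at h5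
        have := h3 i hi
        have := h4 i hin
        rw [h5] at *
        exact hinj _ _ ‹_› ‹_›
      · rw [if_neg hin] at h5
        have := h3 i hi
        rwa [h5] at this
    · intro h
      have h3 : ∀ i < n, a (ζ i) = w i := fun i hi => by
        have := h i (hi.trans_le hnm)
        rwa [if_pos hi] at this
      have h4 := splice_of_lt (a := a) (b := b) hn (ζ := ζ) fun i hi => by rw [h3 i hi]; exact Same.refl _ _
      refine ⟨fun i hi => ?_, fun i hi => ?_⟩
      · rw [h4]
        split_ifs with hin
        · rw [h3 i hin]; exact Same.refl _ _
        · have := h i hi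
          rwa [if_neg hin] at this
      · rw [h4, if_pos hi, h3 i hi]
        exact Same.refl _ _
  rw [hset, infinitePi_real_pi _ _ (fun i _ => by
    split_ifs
    · exact measurableSet_comp ha fun x => x = w i
    · exact measurableSet_comp hb fun x => D.Same e x (w i)), plen_rpow, plen_rpow]
  have h5 : ∀ i, Q.real (if i < n then {j | a j = w i} else {j | D.Same e (b j) (w i)}) =
      D.len e (w i) ^ s * if i < n then D.len f (w i) ^ t else 1 := by
    intro i
    split_ifs
    · exact h1 _
    · rw [h2, mul_one]
  rw [Finset.prod_congr rfl fun i _ => h5 i, Finset.prod_mul_distrib]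
  congr 1
  rw [← Finset.prod_filter]
  refine Finset.prod_congr ?_ fun _ _ => rfl
  ext i
  simp only [Finset.mem_filter, Finset.mem_range]
  omega

/-- For m ≤ n the switch does not affect the event. The first m letters are prescribed and the
following ones only up to their row; row masses are merely bounded above, so equality is lost. -/
lemma real_splice_le_of_tall (ha : Measurable a) (hef : e ≠ f)
    (hinj : ∀ i j, D.Same e i j → D.Same f i j → i = j)
    (h1 : ∀ i, Q.real {j | a j = i} = D.len e i ^ s * D.len f i ^ t)
    (h3 : ∀ i, Q.real {j | D.Same f (a j) i} ≤ D.len f i ^ t)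
    {w : ℕ → I} {m n : ℕ} (hm : D.IsStop e r w m) (hn : D.IsStop f r w n) (hmn : m ≤ n) :
    (Measure.infinitePi fun _ : ℕ => Q).real (D.splice f r a b ⁻¹' D.approx r w) ≤
      D.plen e w m ^ s * D.plen f w n ^ t := by
  have hset : D.splice f r a b ⁻¹' D.approx r w ⊆ Set.pi (Finset.range n)
      fun i => if i < m then {j | a j = w i} else {j | D.Same f (a j) (w i)} := by
    intro ζ
    rw [mem_preimage, approx_iff hef hm hn]
    simp only [Set.mem_pi, Finset.coe_range, Set.mem_Iio]
    rintro ⟨h4, h5⟩ i hi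
    have h6 := same_of_splice hn h5
    have h7 := splice_of_lt (b := b) hn h6 i
    rw [if_pos hi] at h7
    split_ifs with him
    · have := h4 i him
      rw [h7] at this
      exact hinj _ _ this (h6 i hi)
    · exact h6 i hi
  refine (measureReal_mono hset).trans ?_
  rw [infinitePi_real_pi _ _ (fun i _ => by
    split_ifs
    · exact measurableSet_comp ha fun x => x = w i
    · exact measurableSet_comp ha fun x => D.Same f x (w i)), plen_rpow, plen_rpow]
  have h5 : ∀ i, Q.real (if i < m then {j | a j = w i} else {j | D.Same f (a j) (w i)}) ≤
      (if i < m then D.len e (w i) ^ s else 1) * D.len f (w i) ^ t := by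
    intro i
    split_ifs
    · exact (h1 _).le
    · rw [one_mul]; exact h3 _
  refine (Finset.prod_le_prod (fun i _ => measureReal_nonneg) fun i _ => h5 i).trans (le_of_eq ?_)
  rw [Finset.prod_mul_distrib]
  congr 1
  rw [← Finset.prod_filter]
  refine Finset.prod_congr ?_ fun _ _ => rfl
  ext i
  simp only [Finset.mem_filter, Finset.mem_range]
  omega

variable (D) in
/-- The law `ν` gives approximate squares of side `r` at most the mass `r ^ β`, with a converse
bound for the wide ones. -/
def RegularAt (e f : Fin 2) (β : ℝ) (ν : Measure (ℕ → I)) (r : ℝ) : Prop :=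
  ∀ w, ν.real (D.approx r w) ≤ r ^ β ∧
    (D.Wide e f r w → (D.kap * r) ^ β ≤ ν.real (D.approx r w))

/-- Both stopped lengths lie between `kap * r` and r, so the product of their powers is r^(s+t) up
to the factor `kap`^(s+t). -/
lemma regularAt_splice (hr : 0 < r) (hr1 : r ≤ 1) (hs : 0 ≤ s) (ht : 0 ≤ t)
    (ha : Measurable a) (hb : Measurable b) (hef : e ≠ f)
    (hinj : ∀ i j, D.Same e i j → D.Same f i j → i = j)
    (h1 : ∀ i, Q.real {j | a j = i} = D.len e i ^ s * D.len f i ^ t)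
    (h2 : ∀ i, Q.real {j | D.Same e (b j) i} = D.len e i ^ s)
    (h3 : ∀ i, Q.real {j | D.Same f (a j) i} ≤ D.len f i ^ t) :
    D.RegularAt e f (s + t)
      ((Measure.infinitePi fun _ : ℕ => Q).map (D.splice f r a b)) r := by
  intro w
  obtain ⟨m, hm⟩ := D.exists_isStop e hr w
  obtain ⟨n, hn⟩ := D.exists_isStop f hr w
  have hkr : 0 < D.kap * r := mul_pos D.kap_pos hr
  have hup : D.plen e w m ^ s * D.plen f w n ^ t ≤ r ^ (s + t) := by
    rw [Real.rpow_add hr]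
    exact mul_le_mul (Real.rpow_le_rpow (D.plen_pos _ _ _).le hm.plen_le hs)
      (Real.rpow_le_rpow (D.plen_pos _ _ _).le hn.plen_le ht)
      (Real.rpow_nonneg (D.plen_pos _ _ _).le _) (Real.rpow_nonneg hr.le _)
  have hlow : (D.kap * r) ^ (s + t) ≤ D.plen e w m ^ s * D.plen f w n ^ t := by
    rw [Real.rpow_add hkr]
    exact mul_le_mul (Real.rpow_le_rpow hkr.le (hm.lt_plen hr1).le hs)
      (Real.rpow_le_rpow hkr.le (hn.lt_plen hr1).le ht)
      (Real.rpow_nonneg hkr.le _) (Real.rpow_nonneg (D.plen_pos _ _ _).le _)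
  rw [map_measureReal_apply (measurable_splice ha hb) (measurableSet_approx r w)]
  rw [wide_iff hm hn]
  constructor
  · rcases le_total n m with hnm | hmn
    · rw [real_splice_of_wide ha hb hef hinj h1 h2 hm hn hnm]
      exact hup
    · exact (real_splice_le_of_tall ha hef hinj h1 h3 hm hn hmn).trans hup
  · intro hnm
    rw [real_splice_of_wide ha hb hef hinj h1 h2 hm hn hnm]
    exact hlow

end Splice

/-! ### From measures on the symbol space to covering numbers -/

lemma measure_code_preimage_le [MeasurableSpace I] {ν : Measure (ℕ → I)} {e f : Fin 2} (hD : D.Separated e f) {r : ℝ} (hr : 0 < r)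
    (hr1 : r ≤ 1) {M : ℝ≥0∞} (hM : ∀ w, ν (D.approx r w) ≤ M) {U : Set Plane}
    (hU : Metric.ediam U ≤ ENNReal.ofReal r) : ν (D.code ⁻¹' U) ≤ D.multiplicity * M := by
  obtain ⟨T, hT, hTc⟩ := exists_cover_approx hD hr hr1 (S := D.code ⁻¹' U) fun w hw w' hw' k => by
    refine (abs_sub_le_plane_dist _ _ k).trans ?_
    rw [← ENNReal.ofReal_le_ofReal_iff hr.le, ← edist_dist]
    exact (Metric.edist_le_ediam_of_mem (s := U) hw hw').trans hU
  calc ν (D.code ⁻¹' U) ≤ ν (⋃ w ∈ T, D.approx r w) := measure_mono hTc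
    _ ≤ ∑ w ∈ T, ν (D.approx r w) := measure_biUnion_finset_le _ _
    _ ≤ ∑ w ∈ T, M := Finset.sum_le_sum fun w _ => hM w
    _ = T.card * M := by rw [Finset.sum_const, nsmul_eq_mul]
    _ ≤ D.multiplicity * M := by gcongr

section Counting

variable [MeasurableSpace I] [DiscreteMeasurableSpace I] {ν : Measure (ℕ → I)}

/-- A largest disjoint family of squares around points of E covers E by the partition property, and
the total mass limits its size. A square of side r lies in a ball of radius 2r, whence the scale 4r.
-/
lemma coveringNumber_mul_le {r : ℝ} (hr : 0 < r) {E B : Set (ℕ → I)} {m M : ℝ≥0∞} (hm : m ≠ 0)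
    (hM : M ≠ ⊤) (hE : ∀ w ∈ E, m ≤ ν (D.approx r w)) (hEB : ∀ w ∈ E, D.approx r w ⊆ B)
    (hB : ν B ≤ M) : (coveringNumber (4 * r) (D.code '' E) : ℝ≥0∞) * m ≤ M := by
  classical
  let 𝒯 : Set (Finset (ℕ → I)) := {T | (↑T : Set (ℕ → I)) ⊆ E ∧
    (T : Set (ℕ → I)).PairwiseDisjoint (D.approx r)}
  have hcard : ∀ T ∈ 𝒯, (T.card : ℝ≥0∞) * m ≤ M := by
    rintro T ⟨hT1, hT2⟩
    calc (T.card : ℝ≥0∞) * m = ∑ w ∈ T, m := by rw [Finset.sum_const, nsmul_eq_mul]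
      _ ≤ ∑ w ∈ T, ν (D.approx r w) := Finset.sum_le_sum fun w hw => hE w (hT1 hw)
      _ = ν (⋃ w ∈ T, D.approx r w) :=
          (measure_biUnion_finset hT2 fun w _ => measurableSet_approx r w).symm
      _ ≤ ν B := measure_mono (iUnion₂_subset fun w hw => hEB w (hT1 hw))
      _ ≤ M := hB
  have hbdd : BddAbove (Finset.card '' 𝒯) := by
    have hfin : M / m ≠ ⊤ := ENNReal.div_ne_top hM hm
    refine ⟨⌈(M / m).toReal⌉₊, ?_⟩
    rintro _ ⟨T, hT, rfl⟩
    have h1 := hcard T hT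
    have hmt : m ≠ ⊤ ∨ T.card = 0 := by
      by_contra! h
      rw [h.1, ENNReal.mul_top (by exact_mod_cast h.2)] at h1
      exact hM (top_le_iff.1 h1)
    rcases hmt with hmt | h0
    · have h2 := (ENNReal.le_div_iff_mul_le (Or.inl hm) (Or.inl hmt)).2 h1
      have h3 := ENNReal.toReal_mono hfin h2
      rw [ENNReal.toReal_natCast] at h3
      exact_mod_cast h3.trans (Nat.le_ceil _)
    · simp [h0]
  obtain ⟨T, hT, hTmax⟩ := Nat.sSup_mem (s := Finset.card '' 𝒯)
    ⟨0, ∅, by simp [𝒯], rfl⟩ hbdd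
  have hcover : E ⊆ ⋃ w ∈ T, D.approx r w := by
    intro v hv
    by_contra hnot
    simp only [mem_iUnion, not_exists] at hnot
    have hvT : v ∉ T := fun h => hnot v h (D.self_mem_approx r v)
    have hins : insert v T ∈ 𝒯 := by
      refine ⟨by rw [Finset.coe_insert]; exact insert_subset hv hT.1, ?_⟩
      rw [Finset.coe_insert]
      refine hT.2.insert fun w hw _ => disjoint_left.2 fun x hx hx' => ?_
      apply hnot w hw
      rw [← approx_eq_of_mem hr hx', approx_eq_of_mem hr hx]
      exact D.self_mem_approx r v
    have := le_csSup hbdd ⟨_, hins, rfl⟩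
    rw [← hTmax, Finset.card_insert_of_notMem hvT] at this
    omega
  have hN : coveringNumber (4 * r) (D.code '' E) ≤ T.card := by
    refine coveringNumber_le_card T D.code (ρ := 2 * r) ?_ (by linarith)
    rintro _ ⟨v, hv, rfl⟩
    obtain ⟨w, hw, hvw⟩ := mem_iUnion₂.1 (hcover hv)
    exact mem_iUnion₂.2 ⟨w, hw, code_mem_ball_of_mem_approx hr hvw⟩
  refine (mul_le_mul_left ?_ m).trans (hcard T hT)
  exact_mod_cast ENat.toENNReal_mono hN

end Counting

end DiagonalIFS

/-! ### Dimensions from measures on the symbol space -/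

lemma ofReal_div_le_of_le_mul {a b : ℝ} {x : ℝ≥0∞} (hb : 0 < b)
    (h : ENNReal.ofReal a ≤ x * ENNReal.ofReal b) : ENNReal.ofReal (a / b) ≤ x := by
  rw [ENNReal.ofReal_div_of_pos hb]
  exact ENNReal.div_le_of_le_mul h

lemma le_ofReal_div_of_mul_le {a b : ℝ} {x : ℝ≥0∞} (hb : 0 < b)
    (h : x * ENNReal.ofReal b ≤ ENNReal.ofReal a) : x ≤ ENNReal.ofReal (a / b) := by
  rw [ENNReal.ofReal_div_of_pos hb]
  exact (ENNReal.le_div_iff_mul_le (Or.inl (by simpa using hb)) (Or.inl ENNReal.ofReal_ne_top)).2 h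

namespace DiagonalIFS

variable {I : Type*} {D : DiagonalIFS I}

lemma multiplicity_pos : 0 < D.multiplicity := by unfold multiplicity; positivity

lemma measure_code_preimage_le_mul_coveringNumber [MeasurableSpace I] {ν : Measure (ℕ → I)}
    {e f : Fin 2} (hD : D.Separated e f) {r : ℝ} (hr : 0 < r) (hr1 : r ≤ 1) {M : ℝ} (hM0 : 0 < M)
    (hM : ∀ w, ν (D.approx r w) ≤ ENNReal.ofReal M) (E : Set Plane) :
    ν (D.code ⁻¹' E) ≤ (coveringNumber r E : ℝ≥0∞) * ENNReal.ofReal (D.multiplicity * M) := by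
  have hK : (0 : ℝ) < D.multiplicity := by exact_mod_cast D.multiplicity_pos
  refine measure_preimage_le_coveringNumber_mul ν D.code (ENNReal.ofReal_pos.2 (mul_pos hK hM0)).ne'
    (fun U hU => ?_) E
  rw [ENNReal.ofReal_mul hK.le, ENNReal.ofReal_natCast]
  exact measure_code_preimage_le hD hr hr1 hM hU

variable [MeasurableSpace I] [DiscreteMeasurableSpace I]

lemma coveringNumber_range_le {ν : Measure (ℕ → I)} {r c M : ℝ} (hr : 0 < r) (hc : 0 < c)
    (hν : ν univ ≤ ENNReal.ofReal M) (h : ∀ w, ENNReal.ofReal c ≤ ν (D.approx (r / 4) w)) :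
    (coveringNumber r (range D.code) : ℝ≥0∞) ≤ ENNReal.ofReal (M / c) := by
  refine le_ofReal_div_of_mul_le hc ?_
  have h1 := coveringNumber_mul_le (D := D) (ν := ν) (r := r / 4) (by positivity) (E := univ)
    (B := univ) (m := ENNReal.ofReal c) (by simpa using hc) ENNReal.ofReal_ne_top
    (fun w _ => h w) (fun w _ => subset_univ _) hν
  rwa [image_univ, mul_div_cancel₀ r (by norm_num : (4 : ℝ) ≠ 0)] at h1

/-- The measures may change with r. Upper mass bounds give lower bounds for covering numbers and
conversely; the second family need not be normalised, so that sums of two laws are allowed. -/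
lemma hasBoxDim_range {e f : Fin 2} (hD : D.Separated e f) {β : ℝ≥0} {c M : ℝ} (hc : 0 < c)
    (hM : 0 < M)
    (h1 : ∀ r, 0 < r → r ≤ 1 → ∃ ν : Measure (ℕ → I), IsProbabilityMeasure ν ∧
      ∀ w, ν (D.approx r w) ≤ ENNReal.ofReal (M * r ^ (β : ℝ)))
    (h2 : ∀ r, 0 < r → r ≤ 1 → ∃ ν : Measure (ℕ → I), ν univ ≤ ENNReal.ofReal M ∧
      ∀ w, ENNReal.ofReal (c * r ^ (β : ℝ)) ≤ ν (D.approx r w)) :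
    HasBoxDim (range D.code) β ∧ ∃ C > 0, ∀ r, 0 < r → r < 1 →
      (coveringNumber r (range D.code) : ℝ≥0∞) ≤ ENNReal.ofReal (C * (1 / r) ^ (β : ℝ)) := by
  have hK : (0 : ℝ) < D.multiplicity := by exact_mod_cast D.multiplicity_pos
  have hup : ∀ r, 0 < r → r < 1 → (coveringNumber r (range D.code) : ℝ≥0∞) ≤
      ENNReal.ofReal (M / c * 4 ^ (β : ℝ) * (1 / r) ^ (β : ℝ)) := by
    intro r hr hr1
    obtain ⟨ν, hν, hν'⟩ := h2 (r / 4) (by positivity) (by linarith)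
    refine (coveringNumber_range_le hr (by positivity) hν hν').trans_eq ?_
    congr 1
    rw [Real.div_rpow hr.le (by norm_num), one_div, Real.inv_rpow hr.le]
    field_simp
  refine ⟨hasBoxDim_of_bounds (c := 1 / (D.multiplicity * M)) (r₀ := 1) (by positivity)
    (by positivity : 0 < M / c * 4 ^ (β : ℝ)) one_pos (fun r hr hr1 => ?_) hup,
    _, by positivity, hup⟩
  obtain ⟨ν, hν, hν'⟩ := h1 r hr hr1.le
  have h3 := measure_code_preimage_le_mul_coveringNumber hD hr hr1.le
    (by positivity : 0 < M * r ^ (β : ℝ)) hν' (range D.code)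
  rw [preimage_range, measure_univ, ← ENNReal.ofReal_one] at h3
  refine (le_of_eq ?_).trans (ofReal_div_le_of_le_mul (by positivity) h3)
  congr 1
  rw [one_div r, Real.inv_rpow hr.le]
  field_simp

/-- If some measure gives all approximate squares of side `r` a mass comparable to `r ^ β`, all
dimensions of the attractor are equal to `β`. -/
lemma dims_eq_of_regular {e f : Fin 2} (hD : D.Separated e f) [Nonempty I] {β : ℝ≥0} {c C : ℝ}
    (hc : 0 < c) (hC : 0 < C) {ν : Measure (ℕ → I)} (hν0 : ν univ ≠ 0)
    (hlow : ∀ r, 0 < r → r ≤ 1 → ∀ w, ENNReal.ofReal (c * r ^ (β : ℝ)) ≤ ν (D.approx r w))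
    (hup : ∀ r, 0 < r → r ≤ 1 → ∀ w, ν (D.approx r w) ≤ ENNReal.ofReal (C * r ^ (β : ℝ)))
    {C' : ℝ} (hC' : 0 < C') (hcov : ∀ r, 0 < r → r < 1 →
      (coveringNumber r (range D.code) : ℝ≥0∞) ≤ ENNReal.ofReal (C' * (1 / r) ^ (β : ℝ))) :
    lowerDim (range D.code) = β ∧ dimH (range D.code) = β ∧ assouadDim (range D.code) = β := by
  have hK : (0 : ℝ) < D.multiplicity := by exact_mod_cast D.multiplicity_pos
  have hball : ∀ x R, 0 < R → R ≤ 1 / 2 → ν (D.code ⁻¹' Metric.closedBall x R) ≤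
      ENNReal.ofReal (D.multiplicity * (C * (2 * R) ^ (β : ℝ))) := by
    intro x R hR hR1
    rw [ENNReal.ofReal_mul hK.le, ENNReal.ofReal_natCast]
    refine measure_code_preimage_le hD (by positivity) (by linarith) (hup _ (by positivity)
      (by linarith)) (Metric.ediam_le_of_forall_dist_le fun y hy z hz => ?_)
    have := dist_triangle_right y z x
    rw [Metric.mem_closedBall] at hy hz
    linarith
  have hcovlow : ∀ r R : ℝ, 0 < r → r < R → R ≤ 1 → ∀ x ∈ range D.code,
      ENNReal.ofReal (c / (2 ^ (β : ℝ) * D.multiplicity * C) * (R / r) ^ (β : ℝ)) ≤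
        (coveringNumber r (Metric.closedBall x R ∩ range D.code) : ℝ≥0∞) := by
    rintro r R hr hrR hR _ ⟨w, rfl⟩
    have hR0 : 0 < R := hr.trans hrR
    have h1 := measure_code_preimage_le_mul_coveringNumber hD hr (by linarith)
      (by positivity : 0 < C * r ^ (β : ℝ)) (hup r hr (by linarith))
      (Metric.closedBall (D.code w) R ∩ range D.code)
    have h2 : D.approx (R / 2) w ⊆ D.code ⁻¹' (Metric.closedBall (D.code w) R ∩ range D.code) := by
      intro v hv
      refine ⟨Metric.ball_subset_closedBall ?_, mem_range_self v⟩
      have := code_mem_ball_of_mem_approx (by positivity) hv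
      rwa [mul_div_cancel₀ R (by norm_num : (2 : ℝ) ≠ 0)] at this
    have h3 := ((hlow (R / 2) (by positivity) (by linarith) w).trans (measure_mono h2)).trans h1
    refine (le_of_eq ?_).trans (ofReal_div_le_of_le_mul (by positivity) h3)
    congr 1
    rw [Real.div_rpow hR0.le hr.le, Real.div_rpow hR0.le (by norm_num)]
    field_simp
  -- Squares of side r/4 around points of the R-ball stay in the 2R-ball, whose diameter 4R must be
  -- at most 1 for the mass bound.
  have hcovup : ∀ r R : ℝ, 0 < r → r < R → R ≤ 1 / 4 → ∀ x ∈ range D.code,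
      (coveringNumber r (Metric.closedBall x R ∩ range D.code) : ℝ≥0∞) ≤
        ENNReal.ofReal (D.multiplicity * C * 4 ^ (β : ℝ) * 4 ^ (β : ℝ) / c *
          (R / r) ^ (β : ℝ)) := by
    rintro r R hr hrR hR x -
    have hR0 : 0 < R := hr.trans hrR
    have h1 := coveringNumber_mul_le (D := D) (ν := ν) (r := r / 4) (by positivity)
      (E := D.code ⁻¹' Metric.closedBall x R) (B := D.code ⁻¹' Metric.closedBall x (2 * R))
      (m := ENNReal.ofReal (c * (r / 4) ^ (β : ℝ)))
      (by simpa using (by positivity : 0 < c * (r / 4) ^ (β : ℝ))) ENNReal.ofReal_ne_top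
      (fun w _ => hlow _ (by positivity) (by linarith) w) (fun w hw v hv => by
        have h2 := code_mem_ball_of_mem_approx (by positivity) hv
        rw [Metric.mem_ball] at h2
        rw [mem_preimage, Metric.mem_closedBall] at hw ⊢
        have := dist_triangle (D.code v) (D.code w) x
        linarith) (hball x (2 * R) (by positivity) (by linarith))
    rw [image_preimage_eq_inter_range, mul_div_cancel₀ r (by norm_num : (4 : ℝ) ≠ 0)] at h1
    refine (le_ofReal_div_of_mul_le (by positivity) h1).trans_eq ?_
    congr 1
    rw [Real.div_rpow hR0.le hr.le, Real.div_rpow hr.le (by norm_num),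
      show 2 * (2 * R) = 4 * R by ring, Real.mul_rpow (by norm_num) hR0.le]
    field_simp
  have hne : (range D.code).Nonempty := ⟨_, mem_range_self fun _ => Classical.arbitrary I⟩
  refine ⟨le_antisymm ?_ ?_, le_antisymm ?_ ?_, le_antisymm ?_ ?_⟩
  · refine lowerDim_le (C := D.multiplicity * C * 4 ^ (β : ℝ) * 4 ^ (β : ℝ) / c) (δ₀ := 1) one_pos fun δ hδ hδ1 ρ hρ => ?_
    have hR : 0 < min ρ (1 / 4) := by positivity
    obtain ⟨x, hx⟩ := hne
    refine ⟨min ρ (1 / 4), hR, min_le_left _ _, x, hx,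
      (hcovup _ _ (by positivity) (by nlinarith) (min_le_right _ _) x hx).trans_eq ?_⟩
    congr 3
    field_simp
  · exact le_iSup₂_of_le β ⟨_, by positivity, 1, one_pos, hcovlow⟩ le_rfl
  · exact dimH_le_of_coveringNumber_le hC' one_pos hcov
  · refine le_dimH_of_measure_le (ν.map D.code) (C := D.multiplicity * C) (by positivity) ?_ ?_
    · have := Measure.le_map_apply (measurable_code (D := D)).aemeasurable (μ := ν) (range D.code)
      rw [preimage_range] at this
      exact (lt_of_lt_of_le (pos_iff_ne_zero.2 hν0) this).ne'
    · intro r hr hr1 U hU hUr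
      rw [Measure.map_apply measurable_code hU.measurableSet, mul_assoc, ENNReal.ofReal_mul hK.le,
        ENNReal.ofReal_natCast]
      exact measure_code_preimage_le hD hr hr1 (hup r hr hr1) hUr
  · exact iInf₂_le_of_le β ⟨_, by positivity, 1 / 4, by positivity, hcovup⟩ le_rfl
  · exact le_assouadDim hne (by positivity) one_pos hcovlow

end DiagonalIFS

/-! ### The exponents of a diagonal system -/

lemma exists_sum_mul_rpow_eq_one {I : Type*} [Fintype I] {a x : I → ℝ} (ha : 1 ≤ ∑ i, a i)
    (hx0 : ∀ i, 0 < x i) (hx1 : ∀ i, x i < 1) : ∃ t : ℝ≥0, ∑ i, a i * x i ^ (t : ℝ) = 1 := by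
  set g : ℝ → ℝ := fun t => ∑ i, a i * x i ^ t with hg
  have hcont : Continuous g := continuous_finsetSum _ fun i _ =>
    continuous_const.mul (Real.continuous_const_rpow (hx0 i).ne')
  have hlim : Tendsto g atTop (𝓝 0) := by
    have : Tendsto g atTop (𝓝 (∑ i, a i * 0)) := tendsto_finsetSum _ fun i _ =>
      (tendsto_rpow_atTop_of_base_lt_one (x i) (by linarith [hx0 i]) (hx1 i)).const_mul _
    simpa using this
  obtain ⟨T, hT0, hT⟩ := ((eventually_ge_atTop (0 : ℝ)).and
    (hlim.eventually_lt_const zero_lt_one)).exists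
  obtain ⟨t, ht, ht1⟩ := intermediate_value_Icc' hT0 hcont.continuousOn
    (show (1 : ℝ) ∈ Icc (g T) (g 0) from ⟨hT.le, by simpa [hg] using ha⟩)
  exact ⟨⟨t, ht.1⟩, ht1⟩

namespace DiagonalIFS

variable {I : Type*} [Fintype I] (D : DiagonalIFS I)

open Classical in
/-- The maps with the same image in direction `k` as `i`. -/
def fiber (k : Fin 2) (i : I) : Finset I := {j | D.Same k j i}

/-- The exponents `s`, the dimension of the projection to direction `e`, and `s + t`, the exponent
for counting wide approximate squares. -/
structure Exponents (e f : Fin 2) (s t : ℝ≥0) : Prop where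
  sum_fst : ∑ i, (1 / (D.fiber e i).card : ℝ) * D.len e i ^ (s : ℝ) = 1
  sum_snd : ∑ i, D.len e i ^ (s : ℝ) * D.len f i ^ (t : ℝ) = 1

variable {D}

lemma mem_fiber {k : Fin 2} {i j : I} : j ∈ D.fiber k i ↔ D.Same k j i := by simp [fiber]

lemma card_fiber_pos (k : Fin 2) (i : I) : (0 : ℝ) < (D.fiber k i).card := by
  exact_mod_cast Finset.card_pos.2 ⟨i, mem_fiber.2 (Same.refl _ _)⟩

lemma fiber_eq {k : Fin 2} {i j : I} (h : D.Same k j i) : D.fiber k j = D.fiber k i := by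
  ext l
  rw [mem_fiber, mem_fiber]
  exact ⟨fun h' => h'.trans h, fun h' => h'.trans h.symm⟩

lemma sum_fiber_fst (k : Fin 2) (s : ℝ) (i : I) :
    ∑ j ∈ D.fiber k i, (1 / (D.fiber k j).card : ℝ) * D.len k j ^ s = D.len k i ^ s := by
  have : ∀ j ∈ D.fiber k i, (1 / (D.fiber k j).card : ℝ) * D.len k j ^ s =
      (1 / (D.fiber k i).card : ℝ) * D.len k i ^ s := fun j hj => by
    rw [fiber_eq (mem_fiber.1 hj), (mem_fiber.1 hj).2]
  rw [Finset.sum_congr rfl this, Finset.sum_const, nsmul_eq_mul, ← mul_assoc, mul_one_div_cancel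
    (card_fiber_pos k i).ne', one_mul]

variable (D) in
lemma exists_exponents [Nonempty I] (e f : Fin 2) : ∃ s t : ℝ≥0, D.Exponents e f s t := by
  obtain ⟨i₀⟩ := ‹Nonempty I›
  obtain ⟨s, hs⟩ := exists_sum_mul_rpow_eq_one (a := fun i => (1 / (D.fiber e i).card : ℝ))
    (x := D.len e) (by
      have h := sum_fiber_fst (D := D) e 0 i₀
      simp only [Real.rpow_zero, mul_one] at h
      refine h.symm.le.trans ?_
      exact Finset.sum_le_univ_sum_of_nonneg fun i => (one_div_pos.2 (card_fiber_pos (D := D) e i)).le)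
    (D.len_pos e) (D.len_lt_one e)
  obtain ⟨t, ht⟩ := exists_sum_mul_rpow_eq_one (a := fun i => D.len e i ^ (s : ℝ))
    (x := D.len f) (by
      rw [← hs]
      refine Finset.sum_le_sum fun i _ => mul_le_of_le_one_left
        (Real.rpow_nonneg (D.len_pos e i).le _) ?_
      rw [div_le_one (card_fiber_pos e i)]
      exact_mod_cast Nat.one_le_iff_ne_zero.2 (by exact_mod_cast (card_fiber_pos e i).ne'))
    (D.len_pos f) (D.len_lt_one f)
  exact ⟨s, t, hs, ht⟩

/-! ### Row and column sums, and the laws built from the exponents. -/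

namespace Exponents

variable {e f : Fin 2} {s t : ℝ≥0}

/-- Different maps in one row lie in different columns, so this is a part of the sum of c^s over all
columns, which is 1. -/
lemma sum_row_le (h : D.Exponents e f s t)
    (hinj : ∀ i j, D.Same e i j → D.Same f i j → i = j) (i : I) :
    ∑ j ∈ D.fiber f i, D.len e j ^ (s : ℝ) ≤ 1 := by
  classical
  rw [← Finset.sum_congr rfl fun j _ => sum_fiber_fst (D := D) e s j, ← Finset.sum_biUnion]
  · refine le_of_le_of_eq ?_ h.sum_fst
    exact Finset.sum_le_univ_sum_of_nonneg fun j => mul_nonneg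
      (one_div_pos.2 (card_fiber_pos e j)).le (Real.rpow_nonneg (D.len_pos e j).le _)
  · intro j hj j' hj' hne
    refine Finset.disjoint_left.2 fun l hl hl' => hne (hinj j j' ?_ ?_)
    · exact (mem_fiber.1 hl).symm.trans (mem_fiber.1 hl')
    · exact (mem_fiber.1 hj).trans (mem_fiber.1 hj').symm

/-- Grouping the equation for t by columns shows that the column sums have mean 1 with respect to
the column law; dividing by the fiber size counts each column once. -/
lemma sum_mul_column (h : D.Exponents e f s t) :
    ∑ i, (1 / (D.fiber e i).card : ℝ) * D.len e i ^ (s : ℝ) *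
      ∑ j ∈ D.fiber e i, D.len f j ^ (t : ℝ) = 1 := by
  classical
  refine Eq.trans ?_ h.sum_snd
  simp_rw [Finset.mul_sum, fiber, Finset.sum_filter]
  rw [Finset.sum_comm]
  refine Finset.sum_congr rfl fun j _ => ?_
  rw [← sum_fiber_fst (D := D) e s j, Finset.sum_mul, fiber, Finset.sum_filter]
  refine Finset.sum_congr rfl fun i _ => ?_
  have : D.Same e j i ↔ D.Same e i j := ⟨Same.symm, Same.symm⟩
  simp only [this, fiber]

/-- Either all columns have the same dimension or some column is smaller than average. -/
lemma uniform_or_exists_lt (h : D.Exponents e f s t) :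
    (∀ i, ∑ j ∈ D.fiber e i, D.len f j ^ (t : ℝ) = 1) ∨
      ∃ i, ∑ j ∈ D.fiber e i, D.len f j ^ (t : ℝ) < 1 := by
  by_contra! hcon
  obtain ⟨⟨i, hi⟩, hge⟩ := hcon
  have hpos : ∀ i, 0 < (1 / (D.fiber e i).card : ℝ) * D.len e i ^ (s : ℝ) := fun i =>
    mul_pos (one_div_pos.2 (card_fiber_pos e i)) (Real.rpow_pos_of_pos (D.len_pos e i) _)
  have : ∑ i, (1 / (D.fiber e i).card : ℝ) * D.len e i ^ (s : ℝ) <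
      ∑ i, (1 / (D.fiber e i).card : ℝ) * D.len e i ^ (s : ℝ) *
      ∑ j ∈ D.fiber e i, D.len f j ^ (t : ℝ) :=
    Finset.sum_lt_sum (fun j _ => le_mul_of_one_le_right (hpos j).le (hge j))
      ⟨i, Finset.mem_univ i, lt_mul_of_one_lt_right (hpos i) (lt_of_le_of_ne (hge i) hi.symm)⟩
  rw [h.sum_fst, h.sum_mul_column] at this
  exact lt_irrefl _ this

variable [MeasurableSpace I] [DiscreteMeasurableSpace I]

lemma exists_law (h : D.Exponents e f s t) : ∃ μ : Measure I, IsProbabilityMeasure μ ∧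
    (∀ i, μ.real {i} = D.len e i ^ (s : ℝ) * D.len f i ^ (t : ℝ)) ∧
    (∀ i, μ.real {j | D.Same e j i} =
      D.len e i ^ (s : ℝ) * ∑ j ∈ D.fiber e i, D.len f j ^ (t : ℝ)) ∧
    ∀ i, μ.real {j | D.Same f j i} =
      (∑ j ∈ D.fiber f i, D.len e j ^ (s : ℝ)) * D.len f i ^ (t : ℝ) := by
  classical
  obtain ⟨μ, hμ, hμE⟩ := exists_weight_measure _ (fun i => mul_nonneg
    (Real.rpow_nonneg (D.len_pos e i).le s) (Real.rpow_nonneg (D.len_pos f i).le t)) h.sum_snd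
  have hE : ∀ k i, μ.real {j | D.Same k j i} =
      ∑ j ∈ D.fiber k i, D.len e j ^ (s : ℝ) * D.len f j ^ (t : ℝ) := fun k i => by
    rw [hμE]
    exact Finset.sum_congr (by ext; simp [fiber]) fun _ _ => rfl
  refine ⟨μ, hμ, fun i => ?_, fun i => ?_, fun i => ?_⟩
  · rw [hμE, Finset.sum_eq_single_of_mem i (by simp)]
    intro j hj hji
    exact absurd (by simpa using hj) hji
  · rw [hE, Finset.mul_sum]
    exact Finset.sum_congr rfl fun j hj => by rw [(mem_fiber.1 hj).2]
  · rw [hE, Finset.sum_mul]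
    exact Finset.sum_congr rfl fun j hj => by rw [(mem_fiber.1 hj).2]

lemma exists_column_law (h : D.Exponents e f s t) : ∃ μ : Measure I, IsProbabilityMeasure μ ∧
    ∀ i, μ.real {j | D.Same e j i} = D.len e i ^ (s : ℝ) := by
  classical
  obtain ⟨μ, hμ, hμE⟩ := exists_weight_measure _ (fun i => mul_nonneg
    (one_div_pos.2 (card_fiber_pos e i)).le (Real.rpow_nonneg (D.len_pos e i).le s)) h.sum_fst
  refine ⟨μ, hμ, fun i => ?_⟩
  rw [hμE, ← sum_fiber_fst]
  exact Finset.sum_congr (by ext; simp [fiber]) fun _ _ => rfl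

/-- The splice is driven by independent pairs: a letter of law c^s d^t and a letter whose column has
law c^s. -/
lemma exists_regularAt (h : D.Exponents e f s t) (hef : e ≠ f)
    (hinj : ∀ i j, D.Same e i j → D.Same f i j → i = j) {r : ℝ} (hr : 0 < r) (hr1 : r ≤ 1) :
    ∃ ν : Measure (ℕ → I), IsProbabilityMeasure ν ∧ D.RegularAt e f (s + t) ν r := by
  obtain ⟨μ, hμ, h1, -, h3⟩ := h.exists_law
  obtain ⟨μ', hμ', h2⟩ := h.exists_column_law
  have hfst : ∀ E : Set I, (μ.prod μ').real {j | j.1 ∈ E} = μ.real E := fun E => by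
    have : {j : I × I | j.1 ∈ E} = E ×ˢ univ := by ext; simp
    rw [this, measureReal_prod_prod]
    simp
  have hsnd : ∀ E : Set I, (μ.prod μ').real {j | j.2 ∈ E} = μ'.real E := fun E => by
    have : {j : I × I | j.2 ∈ E} = univ ×ˢ E := by ext; simp
    rw [this, measureReal_prod_prod]
    simp
  refine ⟨_, Measure.isProbabilityMeasure_map
    (measurable_splice measurable_fst measurable_snd).aemeasurable,
    regularAt_splice (Q := μ.prod μ') (a := Prod.fst) (b := Prod.snd) hr hr1 s.2 t.2
      measurable_fst measurable_snd hef hinj (fun i => ?_) (fun i => ?_) fun i => ?_⟩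
  · exact (hfst {i}).trans (h1 i)
  · exact (hsnd {j | D.Same e j i}).trans (h2 i)
  · exact ((hfst {j | D.Same f j i}).trans (h3 i)).trans_le (mul_le_of_le_one_left
      (Real.rpow_nonneg (D.len_pos f i).le _) (h.sum_row_le hinj i))

/-- With all column sums equal to 1 the law c^s d^t already has the right column marginals. Both
letters of the splice may then be the same one, the splice is the identity, and the dependence on r
disappears. -/
lemma exists_forall_regularAt (h : D.Exponents e f s t) (hef : e ≠ f)
    (hinj : ∀ i j, D.Same e i j → D.Same f i j → i = j)
    (hunif : ∀ i, ∑ j ∈ D.fiber e i, D.len f j ^ (t : ℝ) = 1) :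
    ∃ ν : Measure (ℕ → I), IsProbabilityMeasure ν ∧
      ∀ r, 0 < r → r ≤ 1 → D.RegularAt e f (s + t) ν r := by
  obtain ⟨μ, hμ, h1, h2, h3⟩ := h.exists_law
  refine ⟨Measure.infinitePi fun _ => μ, inferInstance, fun r hr hr1 => ?_⟩
  have hsplice : D.splice f r (id : I → I) id = id := by
    ext ζ i
    simp [splice]
  have := regularAt_splice (D := D) (Q := μ) (a := id) (b := id) (e := e) (f := f) (s := s) (t := t)
    hr hr1 s.2 t.2
    measurable_id measurable_id hef hinj h1 (fun i => (h2 i).trans (by rw [hunif, mul_one]))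
    (fun i => (h3 i).trans_le (mul_le_of_le_one_left
      (Real.rpow_nonneg (D.len_pos f i).le _) (h.sum_row_le hinj i)))
  rwa [hsplice, Measure.map_id] at this

end Exponents

end DiagonalIFS

/-! ### The upper bound for the lower dimension -/

namespace DiagonalIFS

variable {I : Type*} {D : DiagonalIFS I}

variable (D) in
/-- Either direction `k` is degenerate or two of the maps have ordered images in it. -/
def HasMargin (k : Fin 2) : Prop :=
  (∀ i j, D.Same k i j) ∨ ∃ i j, D.off k i + D.len k i ≤ D.off k j

lemma hasMargin_of_forall {k : Fin 2} (h : ∀ i j, D.Same k i j ∨ D.Disj k i j) :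
    D.HasMargin k := by
  by_contra! hcon
  rw [HasMargin, not_or] at hcon
  push Not at hcon
  obtain ⟨⟨i, j, hij⟩, hno⟩ := hcon
  rcases (h i j).resolve_left hij with h1 | h1
  · exact (hno i j).not_ge h1
  · exact (hno j i).not_ge h1

/-- Points close to a point well inside a cylinder are not separated from the cylinder. -/
lemma not_disj_of_code_close {k : Fin 2} {w v : ℕ → I} {n : ℕ}
    (hord : D.off k (w n) + D.len k (w n) ≤ D.off k (w (n + 1)))
    (hclose : |D.code v k - D.code w k| ≤ D.kap ^ 2 / 2 * D.plen k w n) {i : ℕ} (hi : i < n)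
    (hs : ∀ j < i, D.Same k (v j) (w j)) : ¬ D.Disj k (v i) (w i) := by
  have hk := D.kap_pos
  have hL := D.plen_pos k w n
  have h1 := D.pos_le_code k w (n + 1 + 1)
  have h2 := D.code_le k w (n + 1)
  rw [pos_succ, pos_succ, plen_succ] at h1
  rw [pos_succ, plen_succ] at h2
  have a1 := D.kap_lt_len k (w n)
  have a2 := D.kap_lt_len k (w (n + 1))
  have a3 := D.len_lt_one k (w n)
  have a4 := D.off_nonneg k (w n)
  have a5 := D.off_add_len_le k (w (n + 1))
  rw [abs_le] at hclose
  -- In units of the cylinder length, the two ordered letters keep the point of w at distance at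
  -- least `kap`^2 from the left end and `kap` from the right end; half of the smaller margin is
  -- allowed.
  have hkk : D.kap ^ 2 / 2 < D.kap := by nlinarith
  have b1 : D.kap ^ 2 ≤ D.off k (w n) + D.len k (w n) * D.off k (w (n + 1)) := by nlinarith
  have c1 : D.pos k w n < D.code v k := by
    have : D.plen k w n * D.kap ^ 2 ≤
      D.plen k w n * (D.off k (w n) + D.len k (w n) * D.off k (w (n + 1))) := by gcongr
    nlinarith [mul_pos hL (pow_pos hk 2)]
  have c2 : D.code v k < D.pos k w n + D.plen k w n := by
    have : D.plen k w n * (D.off k (w n) + D.len k (w n)) ≤ D.plen k w n * (1 - D.kap) := by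
      gcongr; linarith
    nlinarith
  have h3 := D.pos_monotone k w (Nat.succ_le_of_lt hi)
  have h4 := D.pos_add_plen_antitone k w (Nat.succ_le_of_lt hi)
  have h5 := D.pos_le_code k v (i + 1)
  have h6 := D.code_le k v (i + 1)
  simp only [Nat.succ_eq_add_one, pos_succ, plen_succ, pos_congr hs, plen_congr hs]
    at h3 h4 h5 h6
  have hp := D.plen_pos k w i
  rintro (h | h) <;> nlinarith

/-- Writing two ordered letters at level n moves the coded point away from both ends of its
cylinder. In a degenerate direction all letters agree and any choice will do. -/
lemma HasMargin.exists_letters [Nonempty I] {k : Fin 2} (h : D.HasMargin k) :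
    ∃ g₁ g₂ : I, ∀ (w v : ℕ → I) (n : ℕ), w n = g₁ → w (n + 1) = g₂ →
      |D.code v k - D.code w k| ≤ D.kap ^ 2 / 2 * D.plen k w n → ∀ i < n,
      (∀ j < i, D.Same k (v j) (w j)) → D.Same k (v i) (w i) ∨ D.Disj k (v i) (w i) →
      D.Same k (v i) (w i) := by
  rcases h with h | ⟨g₁, g₂, h⟩
  · exact ⟨Classical.arbitrary I, Classical.arbitrary I, fun _ _ _ _ _ _ _ _ _ _ => h _ _⟩
  · refine ⟨g₁, g₂, fun w v n h1 h2 hc i hi hs hor =>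
      hor.resolve_right (not_disj_of_code_close ?_ hc hi hs)⟩
    rwa [h1, h2]

lemma len_rpow_le_one (k : Fin 2) (i : I) {τ : ℝ} (hτ : 0 ≤ τ) : D.len k i ^ τ ≤ 1 :=
  Real.rpow_le_one (D.len_pos k i).le (D.len_lt_one k i).le hτ

lemma prod_Ico_rpow (k : Fin 2) (w : ℕ → I) {a b : ℕ} (hab : a ≤ b) (τ : ℝ) :
    ∏ i ∈ Finset.Ico a b, D.len k (w i) ^ τ = (D.plen k w b / D.plen k w a) ^ τ := by
  rw [Real.div_rpow (D.plen_pos _ _ _).le (D.plen_pos _ _ _).le, plen_rpow, plen_rpow,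
    eq_div_iff (Finset.prod_pos fun i _ => Real.rpow_pos_of_pos (D.len_pos _ _) _).ne', mul_comm,
    Finset.prod_range_mul_prod_Ico _ hab]

lemma prod_range_ite {g : ℕ → ℝ} {a b m : ℕ} (hbm : b ≤ m) :
    ∏ i ∈ Finset.range m, (if a ≤ i ∧ i < b then g i else 1) = ∏ i ∈ Finset.Ico a b, g i := by
  rw [← Finset.prod_filter]
  refine Finset.prod_congr ?_ fun _ _ => rfl
  ext i
  simp only [Finset.mem_filter, Finset.mem_range, Finset.mem_Ico]
  omega

variable [MeasurableSpace I] [DiscreteMeasurableSpace I]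

/-- Letters before N are certain, the two margin letters cost γ each, letters up to n inside the
repeated column cost d^τ, those from n to L are free because only their column is prescribed, and
later columns cost c^s. -/
lemma le_real_approx {P : ℕ → Measure I} [∀ i, IsProbabilityMeasure (P i)] {e f : Fin 2}
    (hef : e ≠ f) {r s τ γ : ℝ} (hτ : 0 ≤ τ) (hγ : 0 < γ) {w : ℕ → I}
    {N L m n : ℕ} (hm : D.IsStop e r w m) (hn : D.IsStop f r w n) (hN : N + 2 ≤ L) (hNn : N ≤ n)
    (hnL : n ≤ L) (hLm : L ≤ m) (h0 : ∀ i < N, 1 ≤ (P i).real {w i})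
    (h1 : ∀ i, N ≤ i → i < N + 2 → γ ≤ (P i).real {w i})
    (h2 : ∀ i, N + 2 ≤ i → i < L → D.len f (w i) ^ τ ≤ (P i).real {w i})
    (h3 : ∀ i, N + 2 ≤ i → i < L → 1 ≤ (P i).real {j | D.Same e j (w i)})
    (h4 : ∀ i, L ≤ i → D.len e (w i) ^ s ≤ (P i).real {j | D.Same e j (w i)}) :
    γ ^ 2 * (D.plen f w n / D.plen f w N) ^ τ * (D.plen e w m / D.plen e w L) ^ s ≤
      (Measure.infinitePi P).real (D.approx r w) := by
  let G : ℕ → Set I := fun i => if i < n then {w i} else {j | D.Same e j (w i)}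
  have hG : ∀ i, (P i).real {w i} ≤ (P i).real (G i) := fun i => by
    refine measureReal_mono ?_
    rw [singleton_subset_iff]
    simp only [G]
    split_ifs
    · exact mem_singleton _
    · exact Same.refl _ _
  have hsub : Set.pi (Finset.range m) G ⊆ D.approx r w := by
    intro v hv
    rw [approx_iff hef hm hn]
    simp only [Set.mem_pi, Finset.coe_range, mem_Iio, G] at hv
    refine ⟨fun i hi => ?_, fun i hi => ?_⟩
    · have := hv i hi
      split_ifs at this
      · rw [this]; exact Same.refl _ _
      · exact this
    · have := hv i (by omega)
      rw [if_pos hi] at this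
      rw [this]; exact Same.refl _ _
  -- The factor d^τ is inserted at the margin letters too, where it is at most 1, so that the
  -- product over N ≤ i < n is a quotient of lengths.
  refine le_trans (le_of_eq ?_) ((Finset.prod_le_prod (s := Finset.range m)
    (f := fun i => (if N ≤ i ∧ i < N + 2 then γ else 1) *
      (if N ≤ i ∧ i < n then D.len f (w i) ^ τ else 1) *
      (if L ≤ i ∧ i < m then D.len e (w i) ^ s else 1)) (g := fun i => (P i).real (G i))
      (fun i _ => ?_) fun i hi => ?_).trans
    ((infinitePi_real_pi P _ fun i _ => MeasurableSet.of_discrete).symm.trans_le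
      (measureReal_mono hsub)))
  · rw [Finset.prod_mul_distrib, Finset.prod_mul_distrib, prod_range_ite (by omega),
      prod_range_ite (by omega), prod_range_ite le_rfl, prod_Ico_rpow _ _ hNn,
      prod_Ico_rpow _ _ hLm]
    simp
  · have := Real.rpow_nonneg (D.len_pos f (w i)).le τ
    have := Real.rpow_nonneg (D.len_pos e (w i)).le s
    refine mul_nonneg (mul_nonneg ?_ ?_) ?_ <;> split_ifs <;> linarith
  · have hi := Finset.mem_range.1 hi
    have hf := len_rpow_le_one (D := D) f (w i) hτ
    rcases lt_or_ge i N with c | c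
    · simp only [if_neg (show ¬ (N ≤ i ∧ i < N + 2) by omega),
        if_neg (show ¬ (N ≤ i ∧ i < n) by omega), if_neg (show ¬ (L ≤ i ∧ i < m) by omega), mul_one]
      exact (h0 i c).trans (hG i)
    rcases lt_or_ge i (N + 2) with c' | c'
    · simp only [if_pos (show N ≤ i ∧ i < N + 2 by omega),
        if_neg (show ¬ (L ≤ i ∧ i < m) by omega), mul_one]
      refine le_trans ?_ ((h1 i c c').trans (hG i))
      split_ifs
      · exact mul_le_of_le_one_right hγ.le hf
      · exact (mul_one _).le
    rcases lt_or_ge i L with c'' | c''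
    · simp only [if_neg (show ¬ (N ≤ i ∧ i < N + 2) by omega),
        if_neg (show ¬ (L ≤ i ∧ i < m) by omega), mul_one, one_mul]
      by_cases hin : i < n
      · rw [if_pos ⟨c, hin⟩]
        exact (h2 i c' c'').trans (hG i)
      · rw [if_neg (by tauto)]
        simp only [G, if_neg hin]
        exact h3 i c' c''
    · simp only [if_neg (show ¬ (N ≤ i ∧ i < N + 2) by omega),
        if_neg (show ¬ (N ≤ i ∧ i < n) by omega), if_pos (show L ≤ i ∧ i < m by omega), one_mul]
      simp only [G, if_neg (show ¬ i < n by omega)]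
      exact h4 i c''

variable [Fintype I]

/-- Normalise d^τ on the column; the divisor is at most 1, so the weights only grow. -/
lemma exists_fiber_law {e f : Fin 2} {τ : ℝ} {i₀ : I}
    (hcol : ∑ j ∈ D.fiber e i₀, D.len f j ^ τ ≤ 1) : ∃ μ : Measure I, IsProbabilityMeasure μ ∧
      (∀ i, D.Same e i i₀ → D.len f i ^ τ ≤ μ.real {i}) ∧
      ∀ i, D.Same e i i₀ → 1 ≤ μ.real {j | D.Same e j i} := by
  classical
  set σ := ∑ j ∈ D.fiber e i₀, D.len f j ^ τ with hσ
  have hpos : ∀ j, 0 < D.len f j ^ τ := fun j => Real.rpow_pos_of_pos (D.len_pos f j) _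
  have hσ0 : 0 < σ := Finset.sum_pos (fun j _ => hpos j) ⟨i₀, mem_fiber.2 (Same.refl _ _)⟩
  have hsum : ∑ j, (if D.Same e j i₀ then D.len f j ^ τ / σ else 0) = 1 := by
    rw [← Finset.sum_filter, ← Finset.sum_div, div_eq_one_iff_eq hσ0.ne', hσ, fiber]
  obtain ⟨μ, hμ, hμE⟩ := exists_weight_measure
    (fun j => if D.Same e j i₀ then D.len f j ^ τ / σ else 0)
    (fun j => by split_ifs <;> have := hpos j <;> positivity) hsum
  refine ⟨μ, hμ, fun i hi => ?_, fun i hi => ?_⟩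
  · rw [hμE, Finset.sum_eq_single_of_mem i (by simp)
      fun j hj hji => absurd (by simpa using hj) hji, if_pos hi]
    exact (le_div_iff₀ hσ0).2 (mul_le_of_le_one_right (hpos i).le hcol)
  · rw [hμE, ← hsum, Finset.sum_filter]
    refine (Finset.sum_congr rfl fun j _ => ?_).le
    by_cases hj : D.Same e j i₀
    · rw [if_pos hj, if_pos (show j ∈ {j | D.Same e j i} from hj.trans hi.symm)]
    · rw [if_neg hj, ite_self]

/-- Deep inside the cylinders of a map that contracts more in direction `f` one sees the product of
the projection to direction `e` and of a column, which bounds the lower dimension. -/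
lemma lowerDim_range_le [Nonempty I] {e f : Fin 2} (hD : D.Separated e f) {s t τ : ℝ≥0}
    (hst : D.Exponents e f s t) (hmar : D.HasMargin f) {i₀ k₀ : I}
    (hcol : ∑ j ∈ D.fiber e i₀, D.len f j ^ (τ : ℝ) ≤ 1) (hk₀ : D.len f k₀ < D.len e k₀) :
    lowerDim (range D.code) ≤ (s + τ : ℝ≥0) := by
  have hcond : ∀ i j, D.Same e i j → D.Same f i j ∨ D.Disj f i j := by
    rcases hD.snd with h | h
    · exact fun i j _ => h i j
    · exact h.1
  obtain ⟨h₁, h₂, hh⟩ := (hasMargin_of_forall hD.fst).exists_letters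
  obtain ⟨g₁, g₂, hg⟩ := hmar.exists_letters
  obtain ⟨μp, hμp, hμp1, -, -⟩ := hst.exists_law
  obtain ⟨μc, hμc, hμc1⟩ := hst.exists_column_law
  obtain ⟨μ₀, hμ₀, hμ₀1, hμ₀2⟩ := exists_fiber_law hcol
  have hκ := D.kap_pos
  have hκ1 : D.kap < 1 := (D.kap_lt_len e k₀).trans (D.len_lt_one e k₀)
  have hlam : D.lam < 1 := D.lam_lt_one
  have hlam0 : 0 < D.lam := (D.len_pos e k₀).trans_le (D.len_le_lam e k₀)
  set θ := D.kap ^ 2 / 2 with hθ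
  have hθ0 : 0 < θ := by positivity
  have hθ1 : θ < 1 := by rw [hθ]; nlinarith
  set q := D.len f k₀ / D.len e k₀ with hq
  have hc0 := D.len_pos e k₀
  have hd0 := D.len_pos f k₀
  have hq0 : 0 < q := by positivity
  have hq1 : q < 1 := (div_lt_one hc0).2 hk₀
  set γ := D.kap ^ ((s : ℝ) + t) with hγ
  have hγ0 : 0 < γ := Real.rpow_pos_of_pos hκ _
  have hγμ : ∀ i, γ ≤ μp.real {i} := fun i => by
    rw [hμp1, hγ, Real.rpow_add hκ]
    exact mul_le_mul (Real.rpow_le_rpow hκ.le (D.kap_lt_len e i).le s.2)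
      (Real.rpow_le_rpow hκ.le (D.kap_lt_len f i).le t.2) (Real.rpow_nonneg hκ.le _)
      (Real.rpow_nonneg (D.len_pos e i).le _)
  set c₀ := γ ^ 2 * (D.kap * θ / 4) ^ (τ : ℝ) * (D.kap * θ * q / 4) ^ (s : ℝ) with hc₀
  have hc₀0 : 0 < c₀ := by positivity
  refine lowerDim_le (C := 1 / c₀) (δ₀ := 1) one_pos fun δ hδ hδ1 ρ hρ => ?_
  -- M repetitions of the column bring the height below r before the column changes, and also make R
  -- at most ρ.
  obtain ⟨M, hM⟩ := exists_pow_lt_of_lt_one (show 0 < min ρ (δ * θ / 4) by positivity) hlam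
  rw [lt_min_iff] at hM
  -- The run of k₀ produces the height-to-width ratio q^N, and the block g₁ g₂ i₀^M shrinks the
  -- width by A. With q^N comparable to A, the width at level L is comparable to the height at level
  -- N, and a ball can fill both.
  set A := D.len e g₁ * D.len e g₂ * D.len e i₀ ^ M with hA
  have hA0 : 0 < A := mul_pos (mul_pos (D.len_pos _ _) (D.len_pos _ _)) (pow_pos (D.len_pos _ _) _)
  have hA1 : A < 1 := by
    have h1 := mul_lt_one_of_nonneg_of_lt_one_left (D.len_pos e g₁).le (D.len_lt_one e g₁)
      (D.len_lt_one e g₂).le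
    exact mul_lt_one_of_nonneg_of_lt_one_left (mul_pos (D.len_pos e g₁) (D.len_pos e g₂)).le h1
      (pow_le_one₀ (D.len_pos _ _).le (D.len_lt_one _ _).le)
  have hAM : A ≤ D.lam ^ M := by
    have h1 := mul_le_one₀ (D.len_lt_one e g₁).le (D.len_pos e g₂).le (D.len_lt_one e g₂).le
    exact (mul_le_of_le_one_left (pow_pos (D.len_pos _ _) _).le h1).trans
      (pow_le_pow_left₀ (D.len_pos _ _).le (D.len_le_lam _ _) _)
  -- the first `N` for which the cylinder is flat enough
  obtain ⟨N, hN1, hN2⟩ : ∃ N, q ^ N ≤ A ∧ q * A < q ^ N := by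
    classical
    have hex := (exists_pow_lt_of_lt_one hA0 hq1).imp fun n (hn : q ^ n < A) => hn.le
    refine ⟨Nat.find hex, Nat.find_spec hex, ?_⟩
    cases hfind : Nat.find hex with
    | zero =>
      rw [pow_zero]
      nlinarith
    | succ n =>
      have := Nat.find_min hex (m := n) (by omega)
      rw [not_le] at this
      rw [pow_succ, mul_comm]
      gcongr
  set L := N + 2 + M with hL
  -- A flat run of k₀, the margin in f at level N, the repeated column, then the margin in e at
  -- level L.
  let ω : ℕ → I := fun i => if i < N then k₀ else if i = N then g₁ else if i = N + 1 then g₂ else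
    if i < L then i₀ else if i = L then h₁ else h₂
  have ω0 : ∀ i < N, ω i = k₀ := fun i hi => by simp only [ω, if_pos hi]
  have ω1 : ω N = g₁ := by simp [ω]
  have ω2 : ω (N + 1) = g₂ := by simp [ω]
  have ω3 : ∀ i, N + 2 ≤ i → i < L → ω i = i₀ := fun i hi hi' => by
    simp only [ω, if_neg (show ¬ i < N by omega), if_neg (show ¬ i = N by omega),
      if_neg (show ¬ i = N + 1 by omega), if_pos hi']
  have ω4 : ω L = h₁ := by
    simp only [ω, if_neg (show ¬ L < N by omega), if_neg (show ¬ L = N by omega),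
      if_neg (show ¬ L = N + 1 by omega), lt_irrefl, if_true, if_false]
  have ω5 : ω (L + 1) = h₂ := by
    simp only [ω, if_neg (show ¬ L + 1 < N by omega), if_neg (show ¬ L + 1 = N by omega),
      if_neg (show ¬ L + 1 = N + 1 by omega), if_neg (show ¬ L + 1 < L by omega),
      if_neg (show ¬ L + 1 = L by omega)]
  have hplenN : ∀ k (v : ℕ → I), (∀ i < N, v i = k₀) → D.plen k v N = D.len k k₀ ^ N := by
    intro k v hv
    rw [plen, Finset.prod_congr rfl fun i hi => by rw [hv i (Finset.mem_range.1 hi)]]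
    simp
  have hplenL : D.plen e ω L = D.len e k₀ ^ N * A := by
    rw [plen, hL, Finset.prod_range_add, Finset.prod_range_succ, Finset.prod_range_succ, ω1, ω2]
    have h1 : ∏ i ∈ Finset.range N, D.len e (ω i) = D.len e k₀ ^ N := hplenN e ω ω0
    have h2 : ∏ i ∈ Finset.range M, D.len e (ω (N + 2 + i)) = D.len e i₀ ^ M := by
      rw [Finset.prod_congr rfl fun i hi => by
        rw [ω3 (N + 2 + i) (by omega) (by have := Finset.mem_range.1 hi; omega)]]
      simp
    rw [h1, h2, hA]
    ring
  set d := D.len f k₀ ^ N with hd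
  have hdN : 0 < d := by positivity
  have hdq : d = D.len e k₀ ^ N * q ^ N := by
    rw [hd, hq, div_pow, mul_div_cancel₀]
    positivity
  set R := θ * d with hR
  have hR0 : 0 < R := by positivity
  have hcN1 : D.len e k₀ ^ N ≤ 1 := pow_le_one₀ hc0.le (D.len_lt_one _ _).le
  have hcN0 : 0 < D.len e k₀ ^ N := by positivity
  have hdL : d ≤ D.plen e ω L := by
    rw [hdq, hplenL]; gcongr
  have hLd : q * D.plen e ω L ≤ d := by
    rw [hdq, hplenL]; nlinarith
  have hd1 : d ≤ A := by
    rw [hdq]; exact (mul_le_of_le_one_left (by positivity) hcN1).trans hN1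
  have hRρ : R ≤ ρ := by
    have : R ≤ d := mul_le_of_le_one_left hdN.le hθ1.le
    linarith [hM.1]
  have hdlt : d ≤ 1 := by linarith
  have hR1 : R ≤ 1 := (mul_le_of_le_one_left hdN.le hθ1.le).trans hdlt
  set r := δ * R / 4 with hr
  have hr0 : 0 < r := by positivity
  have hrR : r < R := by rw [hr]; nlinarith
  have hr1 : r ≤ 1 := hrR.le.trans hR1
  refine ⟨R, hR0, hRρ, D.code ω, mem_range_self ω, ?_⟩
  -- By the margins, points of the ball share the columns of ω up to L and its rows up to N, hence
  -- its first N letters exactly.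
  have hE : ∀ v, D.code v ∈ Metric.closedBall (D.code ω) R →
      (∀ i < N, v i = k₀) ∧ ∀ i < L, D.Same e (v i) (ω i) := by
    intro v hv
    have hdist : ∀ k, |D.code v k - D.code ω k| ≤ R := fun k =>
      (abs_sub_le_plane_dist _ _ k).trans (Metric.mem_closedBall.1 hv)
    have he : ∀ i < L, D.Same e (v i) (ω i) := same_of_forall_not_disj fun i hi hs =>
      hh ω v L ω4 ω5 ((hdist e).trans (mul_le_mul_of_nonneg_left hdL hθ0.le)) i hi hs (hD.fst _ _)
    refine ⟨fun i hi => ?_, he⟩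
    have hf : ∀ i < N, D.Same f (v i) (ω i) := same_of_forall_not_disj fun i hi hs =>
      hg ω v N ω1 ω2 ((hdist f).trans_eq (by rw [hplenN f ω ω0])) i hi hs
        (hcond _ _ (he i (by omega)))
    rw [← ω0 i hi]
    exact hD.inj _ _ (he i (by omega)) (hf i hi)
  -- One law for each section of ω: the fixed run, the margin letters, the single column, and
  -- afterwards the projection to e.
  let P : ℕ → Measure I := fun i => if i < N then Measure.dirac k₀ else if i < N + 2 then μp else
    if i < L then μ₀ else μc
  have hP : ∀ i, IsProbabilityMeasure (P i) := fun i => by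
    simp only [P]; split_ifs <;> infer_instance
  have hmeas : ∀ w ∈ D.code ⁻¹' Metric.closedBall (D.code ω) R,
      ENNReal.ofReal (c₀ * δ ^ ((s : ℝ) + τ)) ≤ Measure.infinitePi P (D.approx r w) := by
    intro w hw
    obtain ⟨hw1, hw2⟩ := hE w hw
    obtain ⟨m, hm⟩ := D.exists_isStop e hr0 w
    obtain ⟨n, hn⟩ := D.exists_isStop f hr0 w
    have hNw : D.plen f w N = d := hplenN f w hw1
    have hLw : D.plen e w L = D.plen e ω L := plen_congr hw2
    have hNn : N ≤ n := by
      refine ((hn N).1 ?_).le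
      rw [hNw]
      exact hrR.trans_le (mul_le_of_le_one_left hdN.le hθ1.le)
    have hLm : L ≤ m := by
      refine ((hm L).1 ?_).le
      rw [hLw]
      exact (hrR.trans_le (mul_le_of_le_one_left hdN.le hθ1.le)).trans_le hdL
    have hnL : n ≤ L := by
      by_contra! hlt
      refine ((hn L).2 hlt).not_ge ?_
      have h1 : D.plen f w L ≤ d * D.lam ^ (2 + M) := by
        rw [plen, hL, add_assoc, Finset.prod_range_add, ← hNw]
        refine mul_le_mul_of_nonneg_left ?_ (D.plen_pos f w N).le
        exact D.plen_le_pow f (fun i => w (N + i)) (2 + M)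
      have h2 : D.lam ^ (2 + M) ≤ D.lam ^ M := pow_le_pow_of_le_one hlam0.le hlam.le (by omega)
      have h3 : d * D.lam ^ (2 + M) ≤ d * (δ * θ / 4) := by
        gcongr
        exact h2.trans hM.2.le
      calc D.plen f w L ≤ d * (δ * θ / 4) := h1.trans h3
        _ = r := by rw [hr, hR]; ring
    have hmain := le_real_approx (P := P) hD.ne τ.2 hγ0 hm hn (show N + 2 ≤ L by omega) hNn hnL
      hLm (fun i hi => by
        simp only [P, if_pos hi, hw1 i hi, measureReal_def,
          Measure.dirac_apply_of_mem (mem_singleton k₀), ENNReal.toReal_one, le_refl])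
      (fun i hi hi' => by
        simp only [P, if_neg (show ¬ i < N by omega), if_pos hi']
        exact hγμ _)
      (fun i hi hi' => by
        simp only [P, if_neg (show ¬ i < N by omega), if_neg (show ¬ i < N + 2 by omega),
          if_pos hi']
        exact hμ₀1 _ (ω3 i hi hi' ▸ hw2 i hi'))
      (fun i hi hi' => by
        simp only [P, if_neg (show ¬ i < N by omega), if_neg (show ¬ i < N + 2 by omega),
          if_pos hi']
        exact hμ₀2 _ (ω3 i hi hi' ▸ hw2 i hi'))
      (fun i hi => by
        simp only [P, if_neg (show ¬ i < N by omega), if_neg (show ¬ i < N + 2 by omega),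
          if_neg (show ¬ i < L by omega)]
        exact (hμc1 _).ge)
    rw [← ofReal_measureReal]
    refine ENNReal.ofReal_le_ofReal (le_trans ?_ hmain)
    have e1 : D.kap * θ / 4 * δ ≤ D.plen f w n / D.plen f w N := by
      rw [hNw, le_div_iff₀ hdN]
      refine le_trans (le_of_eq ?_) (hn.lt_plen hr1).le
      rw [hr, hR]; ring
    have e2 : D.kap * θ * q / 4 * δ ≤ D.plen e w m / D.plen e w L := by
      rw [hLw, le_div_iff₀ (D.plen_pos e ω L)]
      refine le_trans ?_ (hm.lt_plen hr1).le
      calc D.kap * θ * q / 4 * δ * D.plen e ω L = D.kap * θ / 4 * δ * (q * D.plen e ω L) := by ring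
        _ ≤ D.kap * θ / 4 * δ * d := by gcongr
        _ = D.kap * r := by rw [hr, hR]; ring
    calc c₀ * δ ^ ((s : ℝ) + τ) = γ ^ 2 * (D.kap * θ / 4 * δ) ^ (τ : ℝ) *
          (D.kap * θ * q / 4 * δ) ^ (s : ℝ) := by
          rw [hc₀, Real.rpow_add hδ, Real.mul_rpow (by positivity) hδ.le,
            Real.mul_rpow (by positivity) hδ.le]
          ring
      _ ≤ _ := by
          have p1 : 0 < D.plen f w n / D.plen f w N := div_pos (D.plen_pos _ _ _) (D.plen_pos _ _ _)
          exact mul_le_mul (mul_le_mul_of_nonneg_left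
            (Real.rpow_le_rpow (by positivity) e1 τ.2) (by positivity))
            (Real.rpow_le_rpow (by positivity) e2 s.2) (by positivity) (by positivity)
  have hcount := coveringNumber_mul_le (D := D) hr0 (B := univ) (M := ENNReal.ofReal 1)
    (ENNReal.ofReal_pos.2 (by positivity : 0 < c₀ * δ ^ ((s : ℝ) + τ))).ne' ENNReal.ofReal_ne_top
    hmeas (fun _ _ => subset_univ _) (by rw [measure_univ, ENNReal.ofReal_one])
  have hfin := le_ofReal_div_of_mul_le (by positivity) hcount
  rw [image_preimage_eq_inter_range, show 4 * r = δ * R by rw [hr]; ring] at hfin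
  refine hfin.trans_eq ?_
  congr 1
  rw [one_div δ, Real.inv_rpow hδ.le, NNReal.coe_add]
  field_simp

end DiagonalIFS

/-! ### The dichotomy -/

/-- Either the lower dimension is smaller than the box dimension, or all dimensions agree. -/
def Dichotomy (F : Set Plane) : Prop :=
  ∃ b : ℝ≥0∞, HasBoxDim F b ∧
    (lowerDim F < b ∨ (lowerDim F = dimH F ∧ dimH F = b ∧ b = assouadDim F))

namespace DiagonalIFS

variable {I : Type*} {D : DiagonalIFS I}

section Regular

variable [MeasurableSpace I] {e f : Fin 2} {β r : ℝ} {ν : Measure (ℕ → I)} [IsProbabilityMeasure ν]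

lemma RegularAt.le (h : D.RegularAt e f β ν r) (w : ℕ → I) :
    ν (D.approx r w) ≤ ENNReal.ofReal (r ^ β) := by
  rw [← ofReal_measureReal]
  exact ENNReal.ofReal_le_ofReal (h w).1

lemma RegularAt.ge (h : D.RegularAt e f β ν r) (hr : 0 < r) {w : ℕ → I} (hw : D.Wide e f r w) :
    ENNReal.ofReal (D.kap ^ β * r ^ β) ≤ ν (D.approx r w) := by
  rw [← ofReal_measureReal, ← Real.mul_rpow D.kap_pos.le hr.le]
  exact ENNReal.ofReal_le_ofReal ((h w).2 hw)

end Regular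

/-- For t = 0 the sum counts at least one term, so t > 0 and continuity leaves room to lower the
exponent. -/
lemma exists_lt_sum_rpow_le_one {ι : Type*} {T : Finset ι} (hT : T.Nonempty) {x : ι → ℝ}
    (hx : ∀ i, 0 < x i) {t : ℝ≥0} (h : ∑ i ∈ T, x i ^ (t : ℝ) < 1) :
    ∃ τ : ℝ≥0, τ < t ∧ ∑ i ∈ T, x i ^ (τ : ℝ) ≤ 1 := by
  have ht : (0 : ℝ) < t := by
    rcases eq_or_ne t 0 with rfl | ht
    · simp only [NNReal.coe_zero, Real.rpow_zero, Finset.sum_const, nsmul_eq_mul, mul_one] at h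
      exact absurd h (not_lt.2 (by exact_mod_cast Finset.card_pos.2 hT))
    · exact_mod_cast pos_iff_ne_zero.2 ht
  have hcont : Continuous fun τ : ℝ => ∑ i ∈ T, x i ^ τ :=
    continuous_finsetSum _ fun i _ => Real.continuous_const_rpow (hx i).ne'
  have h1 : ∀ᶠ τ in 𝓝[<] (t : ℝ), ∑ i ∈ T, x i ^ τ < 1 :=
    nhdsWithin_le_nhds (hcont.tendsto (t : ℝ) |>.eventually_lt_const h)
  obtain ⟨τ, hτ, hτ0, hτt⟩ := (h1.and (Ioo_mem_nhdsLT ht)).exists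
  exact ⟨⟨τ, hτ0.le⟩, by exact_mod_cast hτt, hτ.le⟩

variable [Fintype I] [Nonempty I]

/-- If no column consists of two or more rectangles, all columns have dimension zero. -/
lemma hasMargin_or_uniform {e f : Fin 2} (hD : D.Separated e f) {s t : ℝ≥0}
    (hst : D.Exponents e f s t) :
    D.HasMargin f ∨ ∀ i, ∑ j ∈ D.fiber e i, D.len f j ^ (t : ℝ) = 1 := by
  by_cases h : ∃ i j, D.Same e i j ∧ i ≠ j
  · obtain ⟨i, j, hij, hne⟩ := h
    left; right
    have hdisj : D.Same f i j ∨ D.Disj f i j := by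
      rcases hD.snd with h | h
      · exact h i j
      · exact h.1 i j hij
    rcases hdisj.resolve_left fun h => hne (hD.inj i j hij h) with h | h
    · exact ⟨i, j, h⟩
    · exact ⟨j, i, h⟩
  · push Not at h
    right
    have hsing : ∀ i, ∑ j ∈ D.fiber e i, D.len f j ^ (t : ℝ) = D.len f i ^ (t : ℝ) := fun i => by
      refine Finset.sum_eq_single_of_mem i (mem_fiber.2 (Same.refl _ _)) fun j hj hji => ?_
      exact absurd (h j i (mem_fiber.1 hj)) hji
    rcases eq_or_ne t 0 with rfl | ht
    · intro i
      rw [hsing, NNReal.coe_zero, Real.rpow_zero]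
    -- With t > 0 all singleton columns would have sums below 1, contradicting their mean 1.
    · exfalso
      have hlt : ∀ i, ∑ j ∈ D.fiber e i, D.len f j ^ (t : ℝ) < 1 := fun i => by
        rw [hsing]
        exact Real.rpow_lt_one (D.len_pos f i).le (D.len_lt_one f i)
          (by exact_mod_cast pos_iff_ne_zero.2 ht)
      have hpos : ∀ i, 0 < (1 / (D.fiber e i).card : ℝ) * D.len e i ^ (s : ℝ) := fun i =>
        mul_pos (one_div_pos.2 (card_fiber_pos e i)) (Real.rpow_pos_of_pos (D.len_pos e i) _)
      have := Finset.sum_lt_sum_of_nonempty Finset.univ_nonempty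
        fun i (_ : i ∈ Finset.univ) => mul_lt_of_lt_one_right (hpos i) (hlt i)
      rw [hst.sum_mul_column, hst.sum_fst] at this
      exact lt_irrefl _ this

variable [MeasurableSpace I] [DiscreteMeasurableSpace I]

/-- A deficient column gives an exponent τ < t. In the uniform case τ = t still bounds the lower
dimension, which allows two orientations to be compared. -/
lemma lowerDim_range_lt_or {e f : Fin 2} (hD : D.Separated e f) {s t : ℝ≥0}
    (hst : D.Exponents e f s t) (hmar : D.HasMargin f) {k₀ : I}
    (hk₀ : D.len f k₀ < D.len e k₀) :
    lowerDim (range D.code) < (s + t : ℝ≥0) ∨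
      (∀ i, ∑ j ∈ D.fiber e i, D.len f j ^ (t : ℝ) = 1) ∧
        lowerDim (range D.code) ≤ (s + t : ℝ≥0) := by
  rcases hst.uniform_or_exists_lt with h | ⟨i, hi⟩
  · exact Or.inr ⟨h, lowerDim_range_le hD hst hmar (h k₀).le hk₀⟩
  · obtain ⟨τ, hτ, hτ1⟩ := exists_lt_sum_rpow_le_one ⟨i, mem_fiber.2 (Same.refl _ _)⟩
      (D.len_pos f) hi
    refine Or.inl ((lowerDim_range_le hD hst hmar hτ1 hk₀).trans_lt ?_)
    exact_mod_cast add_lt_add_right hτ s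

lemma dichotomy_of_wide {e f : Fin 2} (hD : D.Separated e f)
    (hle : ∀ i, D.len f i ≤ D.len e i) {k₀ : I} (hk₀ : D.len f k₀ < D.len e k₀) :
    Dichotomy (range D.code) := by
  obtain ⟨s, t, hst⟩ := D.exists_exponents e f
  set β : ℝ≥0 := s + t with hβ
  have hβc : (β : ℝ) = s + t := NNReal.coe_add s t
  have hκ : 0 < D.kap ^ (β : ℝ) := Real.rpow_pos_of_pos D.kap_pos _
  have hreg := fun r hr hr1 => hst.exists_regularAt hD.ne hD.inj (r := r) hr hr1
  rw [← hβc] at hreg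
  obtain ⟨hbox, C', hC', hcov⟩ := hasBoxDim_range hD hκ one_pos
    (fun r hr hr1 => by
      obtain ⟨ν, hν, h⟩ := hreg r hr hr1
      exact ⟨ν, hν, fun w => by rw [one_mul]; exact h.le w⟩)
    (fun r hr hr1 => by
      obtain ⟨ν, hν, h⟩ := hreg r hr hr1
      exact ⟨ν, by rw [measure_univ, ENNReal.ofReal_one], fun w => h.ge hr (wide_of_le hle r w)⟩)
  refine ⟨β, hbox, ?_⟩
  have hcases : lowerDim (range D.code) < β ∨
      ∀ i, ∑ j ∈ D.fiber e i, D.len f j ^ (t : ℝ) = 1 := by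
    rcases hasMargin_or_uniform hD hst with hmar | h
    · exact (lowerDim_range_lt_or hD hst hmar hk₀).imp_right And.left
    · exact Or.inr h
  refine hcases.imp_right fun hunif => ?_
  obtain ⟨ν, hν, h⟩ := hst.exists_forall_regularAt hD.ne hD.inj hunif
  rw [← hβc] at h
  obtain ⟨h1, h2, h3⟩ := dims_eq_of_regular hD hκ one_pos (ν := ν) (by simp)
    (fun r hr hr1 w => (h r hr hr1).ge hr (wide_of_le hle r w))
    (fun r hr hr1 w => by rw [one_mul]; exact (h r hr hr1).le w) hC' hcov
  exact ⟨h1.trans h2.symm, h2, h3.symm⟩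

lemma dichotomy_of_mixed {e f : Fin 2} (hD : D.Separated e f) (hD' : D.Separated f e) {k₀ k₁ : I}
    (hk₀ : D.len f k₀ < D.len e k₀) (hk₁ : D.len e k₁ < D.len f k₁) :
    Dichotomy (range D.code) := by
  obtain ⟨s, t, hst⟩ := D.exists_exponents e f
  obtain ⟨s', t', hst'⟩ := D.exists_exponents f e
  -- The larger exponent governs the box dimension; squares wide only in the other orientation have
  -- even larger lower mass bounds because r and `kap` are at most 1.
  wlog hle : s' + t' ≤ s + t generalizing e f k₀ k₁ s t s' t'
  · exact this hD' hD hk₁ hk₀ s' t' hst' s t hst (le_of_not_ge hle)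
  set β : ℝ≥0 := s + t with hβ
  set β' : ℝ≥0 := s' + t' with hβ'
  have hβc : (β : ℝ) = s + t := NNReal.coe_add s t
  have hβc' : (β' : ℝ) = s' + t' := NNReal.coe_add s' t'
  have hκ : 0 < D.kap ^ (β : ℝ) := Real.rpow_pos_of_pos D.kap_pos _
  have hκ1 : D.kap ≤ 1 := ((D.kap_lt_len e k₀).trans (D.len_lt_one e k₀)).le
  have hlow : ∀ {ν ν' : Measure (ℕ → I)} [IsProbabilityMeasure ν] [IsProbabilityMeasure ν'] {r : ℝ},
      0 < r → r ≤ 1 → D.RegularAt e f β ν r → D.RegularAt f e β' ν' r → ∀ w,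
      ENNReal.ofReal (D.kap ^ (β : ℝ) * r ^ (β : ℝ)) ≤ (ν + ν') (D.approx r w) := by
    intro ν ν' _ _ r hr hr1 h h' w
    rw [Measure.add_apply]
    rcases wide_or_wide e f r w with hw | hw
    · exact (h.ge hr hw).trans le_self_add
    · refine le_trans (ENNReal.ofReal_le_ofReal ?_) ((h'.ge hr hw).trans le_add_self)
      have hle' : (β' : ℝ) ≤ β := by exact_mod_cast hle
      exact mul_le_mul (Real.rpow_le_rpow_of_exponent_ge D.kap_pos hκ1 hle')
        (Real.rpow_le_rpow_of_exponent_ge hr hr1 hle') (Real.rpow_nonneg hr.le _)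
        (Real.rpow_nonneg D.kap_pos.le _)
  have hreg := fun r hr hr1 => hst.exists_regularAt hD.ne hD.inj (r := r) hr hr1
  have hreg' := fun r hr hr1 => hst'.exists_regularAt hD'.ne hD'.inj (r := r) hr hr1
  rw [← hβc] at hreg
  rw [← hβc'] at hreg'
  obtain ⟨hbox, C', hC', hcov⟩ := hasBoxDim_range hD hκ two_pos
    (fun r hr hr1 => by
      obtain ⟨ν, hν, h⟩ := hreg r hr hr1
      refine ⟨ν, hν, fun w => (h.le w).trans (ENNReal.ofReal_le_ofReal ?_)⟩
      linarith [Real.rpow_nonneg hr.le (β : ℝ)])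
    (fun r hr hr1 => by
      obtain ⟨ν, hν, h⟩ := hreg r hr hr1
      obtain ⟨ν', hν', h'⟩ := hreg' r hr hr1
      refine ⟨ν + ν', ?_, hlow hr hr1 h h'⟩
      rw [Measure.add_apply, measure_univ, measure_univ, one_add_one_eq_two]
      simp)
  refine ⟨β, hbox, or_iff_not_imp_left.2 fun hnot => ?_⟩
  rw [not_lt] at hnot
  have hunif := ((lowerDim_range_lt_or hD hst (hasMargin_of_forall hD'.fst) hk₀).resolve_left
    hnot.not_gt).1
  have hnot' : (β' : ℝ≥0∞) ≤ lowerDim (range D.code) := le_trans (by exact_mod_cast hle) hnot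
  obtain ⟨hunif', hle'⟩ := (lowerDim_range_lt_or hD' hst' (hasMargin_of_forall hD.fst)
    hk₁).resolve_left hnot'.not_gt
  -- The lower dimension is squeezed between β and β'; equality makes the upper mass bounds of both
  -- measures compatible.
  have heq : β' = β := le_antisymm hle (by exact_mod_cast hnot.trans hle')
  obtain ⟨ν, hν, h⟩ := hst.exists_forall_regularAt hD.ne hD.inj hunif
  obtain ⟨ν', hν', h'⟩ := hst'.exists_forall_regularAt hD'.ne hD'.inj hunif'
  rw [← hβc] at h
  rw [← hβc'] at h'
  obtain ⟨h1, h2, h3⟩ := dims_eq_of_regular hD hκ two_pos (ν := ν + ν') (by simp)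
    (fun r hr hr1 w => hlow hr hr1 (h r hr hr1) (h' r hr hr1) w)
    (fun r hr hr1 w => by
      have h4 := (h r hr hr1).le w
      have h5 := (h' r hr hr1).le w
      rw [heq] at h5
      rw [Measure.add_apply, two_mul, ENNReal.ofReal_add (Real.rpow_nonneg hr.le _)
        (Real.rpow_nonneg hr.le _)]
      exact add_le_add h4 h5) hC' hcov
  exact ⟨h1.trans h2.symm, h2, h3.symm⟩

end DiagonalIFS

/-! ### Carpets as attractors of diagonal systems -/

namespace DiagonalIFS

variable {I : Type*} {D : DiagonalIFS I}

lemma abs_pos_add_sub_code_le (k : Fin 2) (w : ℕ → I) (n : ℕ) {x B : ℝ} (hx : |x| ≤ B) :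
    |D.pos k w n + D.plen k w n * x - D.code w k| ≤ D.lam ^ n * (B + 1) := by
  have h1 := D.pos_le_code k w n
  have h2 := D.code_le k w n
  have h3 := D.plen_pos k w n
  have hB : 0 ≤ B := (abs_nonneg x).trans hx
  rw [abs_le] at hx
  have h4 : |D.pos k w n + D.plen k w n * x - D.code w k| ≤ D.plen k w n * (B + 1) := by
    rw [abs_le]
    constructor <;> nlinarith
  exact h4.trans (mul_le_mul_of_nonneg_right (D.plen_le_pow k w n) (by linarith))

/-- The attractor of a diagonal system is the set of coded points. -/
lemma eq_range_code {F : Set Plane} (hne : F.Nonempty) (hF : IsCompact F) {S : I → Plane → Plane}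
    (hS : ∀ i p k, S i p k = D.len k i * p k + D.off k i) (h : F = ⋃ i, S i '' F) :
    F = range D.code := by
  obtain ⟨B, hB⟩ := hF.isBounded.exists_norm_le
  have hBk : ∀ x ∈ F, ∀ k, |x k| ≤ B := fun x hx k => (PiLp.norm_apply_le x k).trans (hB x hx)
  have hI : Nonempty I := by
    obtain ⟨x, hx⟩ := hne
    rw [h] at hx
    obtain ⟨i, -⟩ := mem_iUnion.1 hx
    exact ⟨i⟩
  have hlam0 : 0 ≤ D.lam := (D.len_pos 0 hI.some).le.trans (D.len_le_lam 0 hI.some)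
  have hlim : Tendsto (fun n : ℕ => D.lam ^ n * (B + 1)) atTop (𝓝 0) := by
    simpa using (tendsto_pow_atTop_nhds_zero_of_lt_one hlam0 D.lam_lt_one).mul_const (B + 1)
  refine Subset.antisymm (fun x hx => ?_) ?_
  -- Choosing preimages in F repeatedly gives an address of x.
  · have hpre : ∀ y : F, ∃ i, ∃ z : F, S i z = y := by
      rintro ⟨y, hy⟩
      rw [h] at hy
      obtain ⟨i, z, hz, hzy⟩ := mem_iUnion.1 hy
      exact ⟨i, ⟨z, hz⟩, hzy⟩
    choose a b hab using hpre
    let y : ℕ → F := fun n => b^[n] ⟨x, hx⟩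
    let w : ℕ → I := fun n => a (y n)
    have hy : ∀ n, S (w n) (y (n + 1)) = y n := fun n => by
      simp only [y, w, Function.iterate_succ_apply']
      exact hab _
    have hx' : ∀ n k, x k = D.pos k w n + D.plen k w n * (y n : Plane) k := by
      intro n k
      induction n with
      | zero => simp [y]
      | succ n ih =>
        rw [ih, ← hy n, hS, pos_succ, plen_succ]
        ring
    refine ⟨w, ?_⟩
    ext k
    have hle : |x k - D.code w k| ≤ 0 := ge_of_tendsto' hlim fun n => by
      rw [hx' n k]
      exact abs_pos_add_sub_code_le k w n (hBk _ (y n).2 k)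
    linarith [abs_nonpos_iff.1 hle]
  · rintro _ ⟨w, rfl⟩
    obtain ⟨x₀, hx₀⟩ := hne
    have hmem : ∀ n, ∀ x ∈ F, WithLp.toLp 2 (fun k => D.pos k w n + D.plen k w n * x k) ∈ F := by
      intro n
      induction n with
      | zero =>
        intro x hx
        simpa using hx
      | succ n ih =>
        intro x hx
        have hSx : S (w n) x ∈ F := by
          rw [h]
          exact mem_iUnion.2 ⟨w n, x, hx, rfl⟩
        have h1 := ih _ hSx
        simp only [hS] at h1
        simp only [pos_succ, plen_succ]
        convert h1 using 3 with k
        ring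
    -- Conversely, the images of one point of F under the compositions along w remain in F and
    -- converge to the coded point.
    refine hF.isClosed.mem_of_tendsto (b := atTop) (f := fun n : ℕ =>
      (WithLp.toLp 2 (fun k => D.pos k w n + D.plen k w n * x₀ k) : Plane)) ?_
      (Eventually.of_forall fun n => hmem n x₀ hx₀)
    rw [tendsto_iff_dist_tendsto_zero]
    have hlim2 : Tendsto (fun n : ℕ => Real.sqrt 2 * (D.lam ^ n * (B + 1))) atTop (𝓝 0) := by
      simpa using hlim.const_mul (Real.sqrt 2)
    refine squeeze_zero (fun _ => dist_nonneg) (fun n => ?_) hlim2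
    have h1 := fun k => abs_pos_add_sub_code_le (D := D) k w n (hBk x₀ hx₀ k)
    have h2 : 0 ≤ D.lam ^ n * (B + 1) := (abs_nonneg _).trans (h1 0)
    rw [EuclideanSpace.dist_eq, Fin.sum_univ_two, Real.sqrt_le_left (by positivity), mul_pow,
      Real.sq_sqrt (by norm_num), Real.dist_eq, Real.dist_eq]
    have h3 := pow_le_pow_left₀ (abs_nonneg _) (h1 0) 2
    have h4 := pow_le_pow_left₀ (abs_nonneg _) (h1 1) 2
    simp only at h3 h4 ⊢
    linarith

end DiagonalIFS

/-! ### Subdivisions, rectangles and patterns in coordinates. -/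

lemma Subdivision.cut_mem {k : ℕ} (u : Subdivision k) (i : Fin (k + 1)) :
    0 ≤ u.cut i ∧ u.cut i ≤ 1 := by
  rw [← u.cut_zero, ← u.cut_last]
  exact ⟨u.strictMono.monotone (Fin.zero_le i), u.strictMono.monotone (Fin.le_last i)⟩

lemma Subdivision.cut_lt {k : ℕ} (u : Subdivision k) (i : Fin k) :
    u.cut i.castSucc < u.cut i.succ := u.strictMono i.castSucc_lt_succ

lemma Subdivision.sub_lt_one {k : ℕ} (u : Subdivision k) (hk : 2 ≤ k) (i : Fin k) :
    u.cut i.succ - u.cut i.castSucc < 1 := by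
  rcases Nat.eq_zero_or_pos i with h0 | h0
  · have h1 : u.cut i.succ < u.cut (Fin.last k) := u.strictMono (by
      rw [Fin.lt_def]; simp only [Fin.val_succ, Fin.val_last]; omega)
    rw [u.cut_last] at h1
    linarith [(u.cut_mem i.castSucc).1]
  · have h1 : u.cut 0 < u.cut i.castSucc := u.strictMono (by
      rw [Fin.lt_def]; simpa using h0)
    rw [u.cut_zero] at h1
    linarith [(u.cut_mem i.succ).2]

lemma Subdivision.eq_or_le {k : ℕ} (u : Subdivision k) (i j : Fin k) :
    i = j ∨ u.cut i.succ ≤ u.cut j.castSucc ∨ u.cut j.succ ≤ u.cut i.castSucc := by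
  rcases lt_trichotomy i j with h | h | h
  · exact Or.inr (Or.inl (u.strictMono.monotone (by
      rw [Fin.le_def]; simp only [Fin.val_succ, Fin.val_castSucc]; omega)))
  · exact Or.inl h
  · exact Or.inr (Or.inr (u.strictMono.monotone (by
      rw [Fin.le_def]; simp only [Fin.val_succ, Fin.val_castSucc]; omega)))

namespace Rect

/-- The lower end point of the projection of the rectangle to the axis `k`. -/
def lo (Q : Rect) (k : Fin 2) : ℝ := ![Q.left, Q.bottom] k

/-- The upper end point of the projection of the rectangle to the axis `k`. -/
def hi (Q : Rect) (k : Fin 2) : ℝ := ![Q.right, Q.top] k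

lemma ext_lo_hi {Q Q' : Rect} {e f : Fin 2} (hef : e ≠ f) (h1 : Q.lo e = Q'.lo e)
    (h2 : Q.hi e = Q'.hi e) (h3 : Q.lo f = Q'.lo f) (h4 : Q.hi f = Q'.hi f) : Q = Q' := by
  have hl := fin_two_forall hef (p := fun k => Q.lo k = Q'.lo k) h1 h3
  have hh := fin_two_forall hef (p := fun k => Q.hi k = Q'.hi k) h2 h4
  cases Q; cases Q'
  have := hl 0; have := hl 1; have := hh 0; have := hh 1
  simp_all [lo, hi]

lemma map_apply (Q : Rect) (p : Plane) (k : Fin 2) :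
    Q.map p k = (Q.hi k - Q.lo k) * p k + Q.lo k := by
  fin_cases k <;> simp [map, hi, lo, width, height]

lemma isSimilarity_map {Q : Rect} (h : Q.width = Q.height) (h0 : 0 < Q.width) :
    IsSimilarity Q.map := by
  refine ⟨Q.width, h0, fun p q => ?_⟩
  have h1 : Q.map p - Q.map q = Q.width • (p - q) := by
    ext k
    fin_cases k <;> simp [map, ← h] <;> ring
  rw [dist_eq_norm, h1, norm_smul, Real.norm_of_nonneg h0.le, dist_eq_norm]

end Rect

/-- The properties of a pattern of rectangles arranged in columns over the axis `e`. -/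
structure IsColumnPattern (P : Finset Rect) (e f : Fin 2) : Prop where
  ne : e ≠ f
  lo_nonneg : ∀ Q ∈ P, ∀ k, 0 ≤ Q.lo k
  hi_le_one : ∀ Q ∈ P, ∀ k, Q.hi k ≤ 1
  lo_lt_hi : ∀ Q ∈ P, ∀ k, Q.lo k < Q.hi k
  sub_lt_one : ∀ Q ∈ P, ∀ k, Q.hi k - Q.lo k < 1
  columns : ∀ Q ∈ P, ∀ Q' ∈ P, (Q.lo e = Q'.lo e ∧ Q.hi e = Q'.hi e) ∨
    Q.hi e ≤ Q'.lo e ∨ Q'.hi e ≤ Q.lo e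
  cells : (∀ Q ∈ P, ∀ Q' ∈ P, (Q.lo f = Q'.lo f ∧ Q.hi f = Q'.hi f) ∨
      Q.hi f ≤ Q'.lo f ∨ Q'.hi f ≤ Q.lo f) ∨
    ((∀ Q ∈ P, ∀ Q' ∈ P, Q.lo e = Q'.lo e → (Q.lo f = Q'.lo f ∧ Q.hi f = Q'.hi f) ∨
      Q.hi f ≤ Q'.lo f ∨ Q'.hi f ≤ Q.lo f) ∧ ∀ Q ∈ P, Q.hi f - Q.lo f ≤ Q.hi e - Q.lo e)

/-- The map g is meant to be the identity or the exchange of coordinates, which treats both versions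
of the construction at once. -/
lemma IsExtendedLalleyGatzouras.isColumnPattern {P : Finset Rect} {g : Rect → Rect} {e f : Fin 2}
    (hef : e ≠ f) (hl : ∀ Q, (g Q).left = Q.lo e) (hr : ∀ Q, (g Q).right = Q.hi e)
    (hb : ∀ Q, (g Q).bottom = Q.lo f) (ht : ∀ Q, (g Q).top = Q.hi f)
    (h : IsExtendedLalleyGatzouras (g '' P)) :
    IsColumnPattern P e f ∧ ∀ Q ∈ P, Q.hi f - Q.lo f ≤ Q.hi e - Q.lo e := by
  obtain ⟨m, hm, u, n, v, h⟩ := h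
  have key : ∀ Q ∈ P, ∃ (i : Fin m) (j : Fin (n i)), Q.lo e = u.cut i.castSucc ∧
      Q.hi e = u.cut i.succ ∧ Q.lo f = (v i).cut j.castSucc ∧ Q.hi f = (v i).cut j.succ := by
    intro Q hQ
    obtain ⟨⟨i, j, hij⟩, -⟩ := h (g Q) ⟨Q, hQ, rfl⟩
    refine ⟨i, j, ?_, ?_, ?_, ?_⟩
    · rw [← hl, hij]; rfl
    · rw [← hr, hij]; rfl
    · rw [← hb, hij]; rfl
    · rw [← ht, hij]; rfl
  have hle : ∀ Q ∈ P, Q.hi f - Q.lo f ≤ Q.hi e - Q.lo e := by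
    intro Q hQ
    have := (h (g Q) ⟨Q, hQ, rfl⟩).2
    rwa [Rect.height, Rect.width, hl, hr, hb, ht] at this
  refine ⟨⟨hef, fun Q hQ => ?_, fun Q hQ => ?_, fun Q hQ => ?_, fun Q hQ => ?_,
    fun Q hQ Q' hQ' => ?_, Or.inr ⟨fun Q hQ Q' hQ' heq => ?_, hle⟩⟩, hle⟩
  · obtain ⟨i, j, h1, h2, h3, h4⟩ := key Q hQ
    exact fin_two_forall hef (by rw [h1]; exact (u.cut_mem _).1)
      (by rw [h3]; exact ((v i).cut_mem _).1)
  · obtain ⟨i, j, h1, h2, h3, h4⟩ := key Q hQ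
    exact fin_two_forall hef (by rw [h2]; exact (u.cut_mem _).2)
      (by rw [h4]; exact ((v i).cut_mem _).2)
  · obtain ⟨i, j, h1, h2, h3, h4⟩ := key Q hQ
    exact fin_two_forall hef (by rw [h1, h2]; exact u.cut_lt i)
      (by rw [h3, h4]; exact (v i).cut_lt j)
  · obtain ⟨i, j, h1, h2, h3, h4⟩ := key Q hQ
    have he : Q.hi e - Q.lo e < 1 := by rw [h1, h2]; exact u.sub_lt_one hm i
    -- A column may be left uncut, so the height is below 1 only because the base is at least as
    -- long.
    exact fin_two_forall hef he ((hle Q hQ).trans_lt he)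
  · obtain ⟨i, j, h1, h2, -⟩ := key Q hQ
    obtain ⟨i', j', h1', h2', -⟩ := key Q' hQ'
    rw [h1, h2, h1', h2']
    exact (u.eq_or_le i i').imp_left fun h => by rw [h]; exact ⟨rfl, rfl⟩
  · obtain ⟨i, j, h1, h2, h3, h4⟩ := key Q hQ
    obtain ⟨i', j', h1', h2', h3', h4'⟩ := key Q' hQ'
    rw [h1, h1'] at heq
    obtain rfl := Fin.castSucc_injective _ (u.strictMono.injective heq)
    rw [h3, h4, h3', h4']
    exact ((v i).eq_or_le j j').imp_left fun h => by rw [h]; exact ⟨rfl, rfl⟩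

lemma IsBaranski.isColumnPattern {P : Finset Rect} (h : IsBaranski (P : Set Rect)) {e f : Fin 2}
    (hef : e ≠ f) : IsColumnPattern P e f := by
  obtain ⟨m, n, hm, hn, u, v, h⟩ := h
  have h0 : ∀ Q ∈ P, ∃ i : Fin m, Q.lo 0 = u.cut i.castSucc ∧ Q.hi 0 = u.cut i.succ := by
    intro Q hQ
    obtain ⟨i, j, rfl⟩ := h Q hQ
    exact ⟨i, rfl, rfl⟩
  have h1 : ∀ Q ∈ P, ∃ j : Fin n, Q.lo 1 = v.cut j.castSucc ∧ Q.hi 1 = v.cut j.succ := by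
    intro Q hQ
    obtain ⟨i, j, rfl⟩ := h Q hQ
    exact ⟨j, rfl, rfl⟩
  have key : ∀ k : Fin 2, ∃ m : ℕ, 2 ≤ m ∧ ∃ u : Subdivision m,
      ∀ Q ∈ P, ∃ i : Fin m, Q.lo k = u.cut i.castSucc ∧ Q.hi k = u.cut i.succ :=
    fin_two_forall zero_ne_one ⟨m, hm, u, h0⟩ ⟨n, hn, v, h1⟩
  have hsep : ∀ k, ∀ Q ∈ P, ∀ Q' ∈ P, (Q.lo k = Q'.lo k ∧ Q.hi k = Q'.hi k) ∨
      Q.hi k ≤ Q'.lo k ∨ Q'.hi k ≤ Q.lo k := by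
    intro k Q hQ Q' hQ'
    obtain ⟨m, -, u, hu⟩ := key k
    obtain ⟨i, h1, h2⟩ := hu Q hQ
    obtain ⟨i', h1', h2'⟩ := hu Q' hQ'
    rw [h1, h2, h1', h2']
    exact (u.eq_or_le i i').imp_left fun h => by rw [h]; exact ⟨rfl, rfl⟩
  refine ⟨hef, fun Q hQ k => ?_, fun Q hQ k => ?_, fun Q hQ k => ?_, fun Q hQ k => ?_, hsep e,
    Or.inl (hsep f)⟩ <;> obtain ⟨m, hm, u, hu⟩ := key k <;> obtain ⟨i, h1, h2⟩ := hu Q hQ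
  · rw [h1]; exact (u.cut_mem _).1
  · rw [h2]; exact (u.cut_mem _).2
  · rw [h1, h2]; exact u.cut_lt i
  · rw [h1, h2]; exact u.sub_lt_one hm i

lemma IsColumnPattern.exists_diagonalIFS {P : Finset Rect} {e f : Fin 2}
    (h : IsColumnPattern P e f) (hP : P.Nonempty) : ∃ D : DiagonalIFS P,
      (∀ k Q, D.len k Q = Q.1.hi k - Q.1.lo k) ∧ ∀ k Q, D.off k Q = Q.1.lo k := by
  have : Nonempty (Fin 2 × P) := ⟨(0, ⟨_, hP.choose_spec⟩)⟩
  obtain ⟨a, ha⟩ := Finite.exists_min fun x : Fin 2 × P => x.2.1.hi x.1 - x.2.1.lo x.1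
  obtain ⟨b, hb⟩ := Finite.exists_max fun x : Fin 2 × P => x.2.1.hi x.1 - x.2.1.lo x.1
  have ha0 := h.lo_lt_hi a.2.1 a.2.2 a.1
  exact ⟨{ len := fun k Q => Q.1.hi k - Q.1.lo k
           off := fun k Q => Q.1.lo k
           -- Half the shortest side, since all ratios must exceed `kap` strictly.
           kap := (a.2.1.hi a.1 - a.2.1.lo a.1) / 2
           lam := b.2.1.hi b.1 - b.2.1.lo b.1
           kap_pos := by linarith
           kap_lt_len := fun k Q => by have := ha (k, Q); simp only at this; linarith
           len_le_lam := fun k Q => hb (k, Q)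
           lam_lt_one := h.sub_lt_one b.2.1 b.2.2 b.1
           off_nonneg := fun k Q => h.lo_nonneg Q.1 Q.2 k
           off_add_len_le := fun k Q => by
            have := h.hi_le_one Q.1 Q.2 k
            linarith }, fun _ _ => rfl, fun _ _ => rfl⟩

lemma IsColumnPattern.separated {P : Finset Rect} {e f : Fin 2} (h : IsColumnPattern P e f)
    {D : DiagonalIFS P} (hlen : ∀ k Q, D.len k Q = Q.1.hi k - Q.1.lo k)
    (hoff : ∀ k Q, D.off k Q = Q.1.lo k) : D.Separated e f := by
  have hsame : ∀ k (Q Q' : P), D.Same k Q Q' ↔ Q.1.lo k = Q'.1.lo k ∧ Q.1.hi k = Q'.1.hi k := by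
    intro k Q Q'
    rw [DiagonalIFS.Same, hoff, hoff, hlen, hlen]
    refine and_congr_right fun heq => ?_
    rw [heq, sub_left_inj]
  have hdisj : ∀ k (Q Q' : P), D.Disj k Q Q' ↔ Q.1.hi k ≤ Q'.1.lo k ∨ Q'.1.hi k ≤ Q.1.lo k := by
    intro k Q Q'
    rw [DiagonalIFS.Disj, hoff, hoff, hlen, hlen, add_sub_cancel, add_sub_cancel]
  refine ⟨h.ne, fun Q Q' => ?_, ?_, fun Q Q' h1 h2 => ?_⟩
  · rw [hsame, hdisj]
    exact h.columns Q.1 Q.2 Q'.1 Q'.2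
  · refine h.cells.imp (fun hc Q Q' => ?_) fun hc => ⟨fun Q Q' hQ => ?_, fun Q => ?_⟩
    · rw [hsame, hdisj]
      exact hc Q.1 Q.2 Q'.1 Q'.2
    · rw [hsame, hdisj]
      exact hc.1 Q.1 Q.2 Q'.1 Q'.2 ((hsame _ _ _).1 hQ).1
    · rw [hlen, hlen]
      exact hc.2 Q.1 Q.2
  · rw [hsame] at h1 h2
    exact Subtype.ext (Rect.ext_lo_hi h.ne h1.1 h1.2 h2.1 h2.2)

lemma exists_diagonalIFS_of_isAttractor {P : Finset Rect} {F : Set Plane} {e f : Fin 2}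
    (h : IsColumnPattern P e f) (hF : IsAttractor (P : Set Rect) F) : ∃ D : DiagonalIFS P,
      (∀ k Q, D.len k Q = Q.1.hi k - Q.1.lo k) ∧ (∀ k Q, D.off k Q = Q.1.lo k) ∧
        F = range D.code := by
  obtain ⟨hne, hcpt, hFP⟩ := hF
  have hP : P.Nonempty := by
    obtain ⟨x, hx⟩ := hne
    rw [hFP] at hx
    obtain ⟨Q, hQ, -⟩ := mem_iUnion₂.1 hx
    exact ⟨Q, hQ⟩
  obtain ⟨D, hlen, hoff⟩ := h.exists_diagonalIFS hP
  refine ⟨D, hlen, hoff, DiagonalIFS.eq_range_code hne hcpt (S := fun Q : P => Q.1.map)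
    (fun Q p k => by rw [hlen, hoff, Rect.map_apply]) ?_⟩
  rw [iUnion_subtype]
  exact hFP

lemma dichotomy_of_isColumnPattern {P : Finset Rect} {F : Set Plane} {e f : Fin 2}
    (h : IsColumnPattern P e f) (hF : IsAttractor (P : Set Rect) F)
    (hle : ∀ Q ∈ P, Q.hi f - Q.lo f ≤ Q.hi e - Q.lo e)
    (hne : ∃ Q ∈ P, Q.hi f - Q.lo f ≠ Q.hi e - Q.lo e) : Dichotomy F := by
  obtain ⟨D, hlen, hoff, rfl⟩ := exists_diagonalIFS_of_isAttractor h hF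
  obtain ⟨Q, hQ, hQne⟩ := hne
  have : Nonempty P := ⟨⟨Q, hQ⟩⟩
  let _ : MeasurableSpace P := ⊤
  refine DiagonalIFS.dichotomy_of_wide (h.separated hlen hoff) (fun Q => ?_) (k₀ := ⟨Q, hQ⟩) ?_
  · rw [hlen, hlen]
    exact hle Q.1 Q.2
  · rw [hlen, hlen]
    exact lt_of_le_of_ne (hle Q hQ) hQne

/-- If one direction is never the shorter one, it serves as e and all squares are wide. Otherwise
there are maps contracting more strongly in each direction, which is the mixed case. -/
lemma dichotomy_of_isBaranski {P : Finset Rect} {F : Set Plane} (h : IsBaranski (P : Set Rect))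
    (hF : IsAttractor (P : Set Rect) F)
    (hne : ∃ Q ∈ P, Q.hi 1 - Q.lo 1 ≠ Q.hi 0 - Q.lo 0) : Dichotomy F := by
  have h01 := h.isColumnPattern (zero_ne_one (α := Fin 2))
  have h10 := h.isColumnPattern (one_ne_zero (α := Fin 2))
  by_cases hle : ∀ Q ∈ P, Q.hi 1 - Q.lo 1 ≤ Q.hi 0 - Q.lo 0
  · exact dichotomy_of_isColumnPattern h01 hF hle hne
  by_cases hle' : ∀ Q ∈ P, Q.hi 0 - Q.lo 0 ≤ Q.hi 1 - Q.lo 1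
  · exact dichotomy_of_isColumnPattern h10 hF hle' (hne.imp fun Q hQ => ⟨hQ.1, hQ.2.symm⟩)
  push Not at hle hle'
  obtain ⟨Q₁, hQ₁, hlt₁⟩ := hle
  obtain ⟨Q₀, hQ₀, hlt₀⟩ := hle'
  obtain ⟨D, hlen, hoff, rfl⟩ := exists_diagonalIFS_of_isAttractor h01 hF
  have : Nonempty P := ⟨⟨Q₀, hQ₀⟩⟩
  let _ : MeasurableSpace P := ⊤
  exact DiagonalIFS.dichotomy_of_mixed (h01.separated hlen hoff) (h10.separated hlen hoff)
    (k₀ := ⟨Q₀, hQ₀⟩) (k₁ := ⟨Q₁, hQ₁⟩) (by rwa [hlen, hlen]) (by rwa [hlen, hlen])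

end Carpet

end

theorem corollary2p11 (F : Set Carpet.Plane) (hF : Carpet.IsSelfAffineCarpet F) :
    ∃ b : ENNReal, Carpet.HasBoxDim F b ∧
      (Carpet.lowerDim F < b ∨
        (Carpet.lowerDim F = dimH F ∧ dimH F = b ∧ b = Carpet.assouadDim F)) := by
  obtain ⟨P, -, hP, ⟨Q, hQ, hsim⟩, hatt⟩ := hF
  -- A non-degenerate square gives a similarity, so the distinguished rectangle has unequal sides.
  have hne : (∀ Q ∈ P, Q.lo 0 < Q.hi 0) → Q.hi 1 - Q.lo 1 ≠ Q.hi 0 - Q.lo 0 := fun hpos heq =>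
    hsim (Carpet.Rect.isSimilarity_map heq.symm (sub_pos.2 (hpos Q hQ)))
  rcases hP with h | h | h
  · rw [← Set.image_id (P : Set Carpet.Rect)] at h
    obtain ⟨hc, hle⟩ := h.isColumnPattern (zero_ne_one (α := Fin 2)) (fun _ => rfl) (fun _ => rfl)
      (fun _ => rfl) (fun _ => rfl)
    exact Carpet.dichotomy_of_isColumnPattern hc hatt hle
      ⟨Q, hQ, hne fun Q hQ => hc.lo_lt_hi Q hQ 0⟩
  · obtain ⟨hc, hle⟩ := h.isColumnPattern (one_ne_zero (α := Fin 2)) (fun _ => rfl) (fun _ => rfl)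
      (fun _ => rfl) (fun _ => rfl)
    exact Carpet.dichotomy_of_isColumnPattern hc hatt hle
      ⟨Q, hQ, (hne fun Q hQ => hc.lo_lt_hi Q hQ 0).symm⟩
  · exact Carpet.dichotomy_of_isBaranski h hatt
      ⟨Q, hQ, hne fun Q hQ => (h.isColumnPattern
        (zero_ne_one (α := Fin 2))).lo_lt_hi Q hQ 0⟩
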